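/- Let $p$ be an odd prime and let $G=\langle\sigma,\tau:\sigma^p=\tau^2=1,\ \tau\sigma\tau^{-1}=\sigma^{-1}\rangle$ be the dihedral group of order $2p$. A $G$-lattice is a $\mathbb{Z}[G]$-module that is free of finite rank over $\mathbb{Z}$; it is called flabby if the Tate cohomology group $H^{-1}(S,M)$ is zero for every subgroup $S$ of $G$. Let $\zeta\in\mathbb{C}$ be a primitive $p$-th root of unity, $R=\mathbb{Z}[\zeta]$, $R_0=\mathbb{Z}[\zeta+\zeta^{-1}]$ and $P=(1-\zeta)R$. The group $G$ acts on $R$ and on its ideals stable under complex conjugation by letting $\sigma$ act as multiplication by $\zeta$ and $\tau$ as complex conjugation. Let $\mathbb{Z}$ be the trivial lattice of rank one, $\mathbb{Z}_-$ the lattice of rank one on which $\sigma$ acts trivially and $\tau$ as $-1$, and $\mathbb{Z}[H]=\mathbb{Z}[G/\langle\sigma\rangle]$ (where $H=\langle\tau\rangle$ and $\sigma$ acts trivially). For every nonzero ideal $\mathcal{A}$ of $R_0$ consider the lattices $R\mathcal{A}$ and $P\mathcal{A}$, and any $G$-lattices that occur as non-split extensions $$0\to P\mathcal{A}\to V_{\mathcal{A}}\to\mathbb{Z}\to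 0,\qquad 0\to R\mathcal{A}\to X_{\mathcal{A}}\to\mathbb{Z}_-\to 0,$$ $$0\to R\mathcal{A}\to (Y_0)_{\mathcal{A}}\to\mathbb{Z}[H]\to 0,\qquad 0\to P\mathcal{A}\to (Y_1)_{\mathcal{A}}\to\mathbb{Z}[H]\to 0,$$ $$0\to R\mathcal{A}\oplus P\to (Y_2)_{\mathcal{A}}\to\mathbb{Z}[H]\to 0,$$ where $(Y_2)_{\mathcal{A}}$ is required to be indecomposable. (When $\mathcal{A}$ runs through representatives of the ideal classes of $R_0$, these are the lattices of Lee's list of the $7h_p^++3$ indecomposable $G$-lattices, $h_p^+$ being the class number of $R_0$.) Then among these lattices the flabby ones are exactly $$\mathbb{Z},\quad \mathbb{Z}[H],\quad V_{\mathcal{A}},\quad (Y_0)_{\mathcal{A}},\quad (Y_1)_{\mathcal{A}},\quad (Y_2)_{\mathcal{A}};$$ that is, for every nonzero ideal $\mathcal{A}$ of $R_0$ these lattices are flabby, and the remaining ones $\mathbb{Z}_-$, $R\mathcal{A}$, $P\mathcal{A}$, $X_{\mathcal{A}}$ are not flabby. -/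

import Mathlib

open DihedralGroup

noncomputable section

namespace DpLattice

/-! ### Lattices over a finite group

A `G`-lattice is a representation `ρ : Representation ℤ G M` of `G` on a free abelian group `M` of
finite rank. -/

section General

variable {G : Type} [Group G]

/-- A representation `ρ` of a finite group `G` over `ℤ` is flabby if the Tate cohomology group
`H⁻¹(S, M)` vanishes for every subgroup `S` of `G`. -/
def IsFlabby [Finite G] {M : Type} [AddCommGroup M] [Module ℤ M]
    (ρ : Representation ℤ G M) : Prop :=
  ∀ S : Subgroup G,
    letI : Fintype S := Fintype.ofFinite S
    Subsingleton (tateCohomology (Rep.of (ρ.comp S.subtype)) (-1))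

variable {A B M : Type*} [AddCommGroup A] [Module ℤ A] [AddCommGroup B] [Module ℤ B]
  [AddCommGroup M] [Module ℤ M]

/-- `M` is indecomposable: it is nonzero and in every decomposition `M = N₁ ⊕ N₂` into
`G`-stable subgroups one of the summands is zero. -/
def IsIndecomposable (ρ : Representation ℤ G M) : Prop :=
  Nontrivial M ∧ ∀ N₁ N₂ : Subrepresentation ρ, IsCompl N₁ N₂ → N₁ = ⊥ ∨ N₂ = ⊥

/-- `M` is the middle term of a short exact sequence `0 → A → M → B → 0` of `G`-modules which
does not split. -/
def IsNonsplitExtension (α : Representation ℤ G A) (β : Representation ℤ G B)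
    (ρ : Representation ℤ G M) : Prop :=
  ∃ (f : Representation.IntertwiningMap α ρ) (g : Representation.IntertwiningMap ρ β),
    Function.Injective f ∧ Function.Exact f g ∧ Function.Surjective g ∧
      ¬ ∃ s : Representation.IntertwiningMap β ρ, ∀ b : B, g (s b) = b

end General

/-! ### The lattices of rank one and two

The dihedral group of order `2p` is `DihedralGroup p`, with `σ = r 1` and `τ = sr 0`; thus
`r i = σ ^ i`, `sr i = τ * σ ^ i` and `τ * σ * τ⁻¹ = σ⁻¹`. -/

/-- The lattice `ℤ` with trivial action. -/
abbrev trivLattice (p : ℕ) : Representation ℤ (DihedralGroup p) ℤ :=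
  Representation.trivial ℤ (DihedralGroup p) ℤ

/-- The lattice `ℤ₋`: `σ` acts trivially and `τ` acts as `-1`. -/
def signLattice (p : ℕ) : Representation ℤ (DihedralGroup p) ℤ where
  toFun
    | r _ => LinearMap.id
    | sr _ => -LinearMap.id
  map_one' := rfl
  map_mul' := by
    rintro (i | i) (j | j) <;> ext <;> simp

/-- The permutation lattice `ℤ[G/⟨σ⟩]`, which is `ℤ[H]` for `H = ⟨τ⟩` with `σ` acting trivially. -/
abbrev permLattice (p : ℕ) : Representation ℤ (DihedralGroup p)
    (MonoidAlgebra ℤ (DihedralGroup p ⧸ Subgroup.zpowers (r 1 : DihedralGroup p))) :=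
  Representation.ofMulAction ℤ (DihedralGroup p)
    (DihedralGroup p ⧸ Subgroup.zpowers (r 1 : DihedralGroup p))

/-! ### The cyclotomic lattices -/

/-- `R = ℤ[ζ]`. -/
abbrev R (ζ : ℂ) : Subalgebra ℤ ℂ := Algebra.adjoin ℤ {ζ}

/-- `R₀ = ℤ[ζ + ζ⁻¹]`. -/
abbrev R₀ (ζ : ℂ) : Subalgebra ℤ ℂ := Algebra.adjoin ℤ {ζ + ζ⁻¹}

/-- The element `ζ` of `R = ℤ[ζ]`. -/
def zeta (ζ : ℂ) : R ζ := ⟨ζ, Algebra.self_mem_adjoin_singleton ℤ ζ⟩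

section Cyclotomic

variable {p : ℕ} {ζ : ℂ}

theorem zeta_pow (hζ : IsPrimitiveRoot ζ p) : zeta ζ ^ p = 1 :=
  Subtype.ext (by simpa [zeta] using hζ.pow_eq_one)

/-- The power `ζ ^ i` in `R`, for an exponent `i` modulo `p`. -/
def zetaPow (ζ : ℂ) (i : ZMod p) : R ζ := zeta ζ ^ i.val

theorem zetaPow_zero : zetaPow ζ (0 : ZMod p) = 1 := by simp [zetaPow]

variable [NeZero p]

theorem inv_mem (hζ : IsPrimitiveRoot ζ p) : ζ⁻¹ ∈ R ζ := by
  have h : ζ⁻¹ = ζ ^ (p - 1) := by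
    refine inv_eq_of_mul_eq_one_right ?_
    rw [← pow_succ', Nat.sub_add_cancel (Nat.one_le_iff_ne_zero.2 (NeZero.ne p)), hζ.pow_eq_one]
  rw [h]
  exact pow_mem (Algebra.self_mem_adjoin_singleton ℤ ζ) _

theorem conj_zeta (hζ : IsPrimitiveRoot ζ p) : starRingEnd ℂ ζ = ζ⁻¹ :=
  (Complex.inv_eq_conj (hζ.norm'_eq_one (NeZero.ne p))).symm

theorem R₀_le (hζ : IsPrimitiveRoot ζ p) : R₀ ζ ≤ R ζ := by
  refine Algebra.adjoin_le ?_
  rintro x rfl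
  exact add_mem (Algebra.self_mem_adjoin_singleton ℤ ζ) (inv_mem hζ)

theorem conj_mem (hζ : IsPrimitiveRoot ζ p) (x : ℂ) (hx : x ∈ R ζ) : starRingEnd ℂ x ∈ R ζ := by
  induction hx using Algebra.adjoin_induction with
  | mem x hx => obtain rfl := hx; rw [conj_zeta hζ]; exact inv_mem hζ
  | algebraMap n => simp
  | add x y _ _ hx hy => rw [map_add]; exact add_mem hx hy
  | mul x y _ _ hx hy => rw [map_mul]; exact mul_mem hx hy

theorem conj_eq_of_mem_R₀ (hζ : IsPrimitiveRoot ζ p) (x : ℂ) (hx : x ∈ R₀ ζ) :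
    starRingEnd ℂ x = x := by
  induction hx using Algebra.adjoin_induction with
  | mem x hx => obtain rfl := hx; rw [map_add, map_inv₀, conj_zeta hζ, inv_inv, add_comm]
  | algebraMap n => simp
  | add x y _ _ hx hy => rw [map_add, hx, hy]
  | mul x y _ _ hx hy => rw [map_mul, hx, hy]

/-- Complex conjugation on `R`. -/
def conjR (hζ : IsPrimitiveRoot ζ p) : R ζ →+* R ζ :=
  (starRingEnd ℂ).restrict (R ζ) (R ζ) (conj_mem hζ)

/-- The inclusion `R₀ ⊆ R`. -/
def incl (hζ : IsPrimitiveRoot ζ p) : R₀ ζ →+* R ζ :=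
  (RingHom.id ℂ).restrict (R₀ ζ) (R ζ) fun _ hx => R₀_le hζ hx

theorem coe_conjR (hζ : IsPrimitiveRoot ζ p) (x : R ζ) :
    (conjR hζ x : ℂ) = starRingEnd ℂ (x : ℂ) := rfl

theorem coe_incl (hζ : IsPrimitiveRoot ζ p) (x : R₀ ζ) : (incl hζ x : ℂ) = (x : ℂ) :=
  RingHom.coe_restrict_apply _ _ _ _ _

theorem zetaPow_add (hζ : IsPrimitiveRoot ζ p) (i j : ZMod p) :
    zetaPow ζ (i + j) = zetaPow ζ i * zetaPow ζ j := by
  rw [zetaPow, zetaPow, zetaPow, ← pow_add, ZMod.val_add, ← pow_eq_pow_mod _ (zeta_pow hζ)]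

theorem conjR_conjR (hζ : IsPrimitiveRoot ζ p) (x : R ζ) : conjR hζ (conjR hζ x) = x :=
  Subtype.ext (Complex.conj_conj _)

theorem conjR_zeta_mul (hζ : IsPrimitiveRoot ζ p) : conjR hζ (zeta ζ) * zeta ζ = 1 := by
  refine Subtype.ext ?_
  change starRingEnd ℂ ζ * ζ = 1
  rw [conj_zeta hζ, inv_mul_cancel₀ (hζ.ne_zero (NeZero.ne p))]

theorem conjR_zetaPow (hζ : IsPrimitiveRoot ζ p) (i : ZMod p) :
    conjR hζ (zetaPow ζ i) = zetaPow ζ (-i) := by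
  have h1 : conjR hζ (zetaPow ζ i) * zetaPow ζ i = 1 := by
    rw [zetaPow, map_pow, ← mul_pow, conjR_zeta_mul hζ, one_pow]
  have h2 : zetaPow ζ i * zetaPow ζ (-i) = 1 := by
    rw [← zetaPow_add hζ, add_neg_cancel, zetaPow_zero]
  exact left_inv_eq_right_inv h1 h2

/-- The lattice `R`: `σ` acts as multiplication by `ζ` and `τ` as complex conjugation. -/
def cycLattice (hζ : IsPrimitiveRoot ζ p) : Representation ℤ (DihedralGroup p) (R ζ) where
  toFun
    | r i => LinearMap.mulLeft ℤ (zetaPow ζ i)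
    | sr i => (conjR hζ).toIntAlgHom.toLinearMap ∘ₗ LinearMap.mulLeft ℤ (zetaPow ζ i)
  map_one' := by
    rw [one_def]
    refine LinearMap.ext fun x => ?_
    simp [zetaPow_zero]
  map_mul' := by
    rintro (i | i) (j | j) <;> refine LinearMap.ext fun x => ?_ <;>
      simp [zetaPow_add hζ, conjR_zetaPow hζ, conjR_conjR hζ, sub_eq_add_neg] <;> ring

/-- An ideal of `R` stable under complex conjugation, as a `G`-stable subgroup of `R`. -/
def idealLattice (hζ : IsPrimitiveRoot ζ p) (I : Ideal (R ζ)) (hI : I.map (conjR hζ) ≤ I) :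
    Subrepresentation (cycLattice hζ) where
  toSubmodule := I.restrictScalars ℤ
  apply_mem_toSubmodule := by
    rintro (i | i) v hv
    · exact I.mul_mem_left _ hv
    · exact hI (Ideal.mem_map_of_mem _ (I.mul_mem_left _ hv))

/-- The ideal `P = (1 - ζ)` of `R`. -/
def idealP (ζ : ℂ) : Ideal (R ζ) := Ideal.span {1 - zeta ζ}

/-- The ideal `RA` of `R` generated by an ideal `A` of `R₀`. -/
def extendIdeal (hζ : IsPrimitiveRoot ζ p) (A : Ideal (R₀ ζ)) : Ideal (R ζ) := A.map (incl hζ)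

theorem idealP_stable (hζ : IsPrimitiveRoot ζ p) : (idealP ζ).map (conjR hζ) ≤ idealP ζ := by
  rw [idealP, Ideal.map_span, Set.image_singleton, Ideal.span_singleton_le_iff_mem,
    Ideal.mem_span_singleton]
  refine ⟨-conjR hζ (zeta ζ), ?_⟩
  rw [map_sub, map_one]
  linear_combination -conjR_zeta_mul hζ

theorem conjR_incl (hζ : IsPrimitiveRoot ζ p) (x : R₀ ζ) : conjR hζ (incl hζ x) = incl hζ x := by
  refine Subtype.ext ?_
  rw [coe_conjR, coe_incl, conj_eq_of_mem_R₀ hζ x x.2]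

theorem extendIdeal_stable (hζ : IsPrimitiveRoot ζ p) (A : Ideal (R₀ ζ)) :
    (extendIdeal hζ A).map (conjR hζ) ≤ extendIdeal hζ A := by
  rw [Ideal.map_le_iff_le_comap, extendIdeal, Ideal.map_le_iff_le_comap]
  intro x hx
  rw [Ideal.mem_comap, Ideal.mem_comap, conjR_incl]
  exact Ideal.mem_map_of_mem _ hx

theorem mul_stable (hζ : IsPrimitiveRoot ζ p) (A : Ideal (R₀ ζ)) :
    (idealP ζ * extendIdeal hζ A).map (conjR hζ) ≤ idealP ζ * extendIdeal hζ A := by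
  rw [Ideal.map_mul]
  exact Ideal.mul_mono (idealP_stable hζ) (extendIdeal_stable hζ A)

/-- The lattice `P`. -/
abbrev latticeP (hζ : IsPrimitiveRoot ζ p) :=
  (idealLattice hζ (idealP ζ) (idealP_stable hζ)).toRepresentation

/-- The lattice `RA`. -/
abbrev latticeRA (hζ : IsPrimitiveRoot ζ p) (A : Ideal (R₀ ζ)) :=
  (idealLattice hζ (extendIdeal hζ A) (extendIdeal_stable hζ A)).toRepresentation

/-- The lattice `PA`. -/
abbrev latticePA (hζ : IsPrimitiveRoot ζ p) (A : Ideal (R₀ ζ)) :=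
  (idealLattice hζ (idealP ζ * extendIdeal hζ A) (mul_stable hζ A)).toRepresentation

/-! ### The extensions in Lee's list

Each predicate says that `M` is (a representative of the isomorphism class of) the lattice of that
name. For `V_A`, `X_A`, `(Y₀)_A`, `(Y₁)_A` it is enough to ask for a non-split extension, which is
then indecomposable. For `(Y₂)_A` indecomposability has to be asked for, since for instance
`(Y₀)_A ⊕ P` is a non-split extension of `ℤ[H]` by `RA ⊕ P` too. -/

variable {M : Type*} [AddCommGroup M] [Module ℤ M]

/-- `M` is `V_A`: a non-split extension `0 → PA → M → ℤ → 0`. -/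
def IsV (hζ : IsPrimitiveRoot ζ p) (A : Ideal (R₀ ζ))
    (ρ : Representation ℤ (DihedralGroup p) M) : Prop :=
  IsNonsplitExtension (latticePA hζ A) (trivLattice p) ρ

/-- `M` is `X_A`: a non-split extension `0 → RA → M → ℤ₋ → 0`. -/
def IsX (hζ : IsPrimitiveRoot ζ p) (A : Ideal (R₀ ζ))
    (ρ : Representation ℤ (DihedralGroup p) M) : Prop :=
  IsNonsplitExtension (latticeRA hζ A) (signLattice p) ρ

/-- `M` is `(Y₀)_A`: a non-split extension `0 → RA → M → ℤ[H] → 0`. -/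
def IsY₀ (hζ : IsPrimitiveRoot ζ p) (A : Ideal (R₀ ζ))
    (ρ : Representation ℤ (DihedralGroup p) M) : Prop :=
  IsNonsplitExtension (latticeRA hζ A) (permLattice p) ρ

/-- `M` is `(Y₁)_A`: a non-split extension `0 → PA → M → ℤ[H] → 0`. -/
def IsY₁ (hζ : IsPrimitiveRoot ζ p) (A : Ideal (R₀ ζ))
    (ρ : Representation ℤ (DihedralGroup p) M) : Prop :=
  IsNonsplitExtension (latticePA hζ A) (permLattice p) ρ

/-- `M` is `(Y₂)_A`: an indecomposable non-split extension `0 → RA ⊕ P → M → ℤ[H] → 0`. -/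
def IsY₂ (hζ : IsPrimitiveRoot ζ p) (A : Ideal (R₀ ζ))
    (ρ : Representation ℤ (DihedralGroup p) M) : Prop :=
  IsNonsplitExtension ((latticeRA hζ A).prod (latticeP hζ)) (permLattice p) ρ ∧
    IsIndecomposable ρ

end Cyclotomic

end DpLattice

end

/-!
A Tate group `H⁻¹(S, M)` is the group of elements of `S`-norm zero modulo the augmentation part, so
flabbiness is a condition on elements, and it need only be tested on the Sylow subgroups `⟨σ⟩` and
`⟨τ⟩` (`isFlabby_of_sylow`).

For `⟨τ⟩`: the ring `R` contains an element of trace one for complex conjugation, hence all stable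
ideals of `R` are cohomologically trivial for `⟨τ⟩`. The condition at `τ` therefore depends only on
the quotient in each extension; it holds for `ℤ` and `ℤ[H]` and fails for `ℤ₋`. This excludes `ℤ₋`
and `X_A`.

For `⟨σ⟩`: on a nonzero stable ideal `I` the norm is zero, while `(σ - 1) I = P I` has index `p`
in `I` (`sigmaMaximal_idealLattice`). This excludes `RA` and `PA`. In an extension `M` of `ℤ` or
`ℤ[H]` by `I`, the condition at `σ` says that `I ⊆ (σ - 1) M`. If `v` lifts a generator of the
quotient, then either `σ v - v` is not in `P I`, and together with `P I` it generates `I`, or `v`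
can be changed into a `σ`-invariant lift, which splits the extension. Thus `V_A`, `(Y₀)_A` and
`(Y₁)_A` are flabby.

For `(Y₂)_A` write `σ v - v = (a₁, a₂)` in `RA ⊕ P`. Since `τ` acts as `1` on `RA / P RA` and
as `-1` on `P / P²`, and `p` is odd, the elements `(a₁, 0)` and `(0, a₂)` both lie in
`(σ - 1) M`. If one of the components lies in `P RA` or `P²`, the corresponding summand splits
off (`not_isIndecomposable_of_apply_sub_mem`); otherwise `(σ - 1) M` contains both summands.
-/

noncomputable section

namespace DpLattice

/-! ### Flabbiness in terms of elements -/

open CategoryTheory groupHomology in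
/-- The Tate group `H⁻¹` is the kernel of the norm on the coinvariants: it vanishes iff every
element of norm zero lies in the augmentation submodule `I_G M`. -/
theorem subsingleton_tateCohomology_neg_one_iff {k G : Type} [CommRing k] [Group G] [Fintype G]
    (M : Rep.{0} k G) :
    Subsingleton (tateCohomology M (-1)) ↔
      ∀ m : M, M.ρ.norm m = 0 → m ∈ Representation.Coinvariants.ker M.ρ := by
  have h1 : Subsingleton (tateCohomology M (-1)) ↔ (tateComplex M).ExactAt (-1) := by
    rw [HomologicalComplex.exactAt_iff_isZero_homology]
    exact (ModuleCat.isZero_iff_subsingleton).symm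
  rw [h1, HomologicalComplex.exactAt_iff' _ (-2) (-1) 0 (by simp) (by simp),
    ShortComplex.moduleCat_exact_iff, ← range_d₁₀_eq_coinvariantsKer]
  have hd : ∀ y : (inhomogeneousChains M).X 1, (chainsIso₀ M).hom ((inhomogeneousChains M).d 1 0 y)
      = d₁₀ M ((chainsIso₁ M).hom y) := fun y => congr($(comp_d₁₀_eq M) y).symm
  have hn : ∀ x : (inhomogeneousChains M).X 0, M.tateNorm x = 0 ↔
      M.ρ.norm ((chainsIso₀ M).hom x) = 0 := by
    intro x
    change (groupCohomology.cochainsIso₀ M).inv (M.ρ.norm ((chainsIso₀ M).hom x)) = 0 ↔ _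
    exact map_eq_zero_iff _ (groupCohomology.cochainsIso₀ M).symm.toLinearEquiv.injective
  change (∀ x : (inhomogeneousChains M).X 0, M.tateNorm x = 0 →
    ∃ y : (inhomogeneousChains M).X 1, (inhomogeneousChains M).d 1 0 y = x) ↔ _
  constructor
  · intro h m hm
    obtain ⟨x, rfl⟩ := (chainsIso₀ M).toLinearEquiv.surjective m
    obtain ⟨y, rfl⟩ := h x ((hn x).2 hm)
    exact ⟨_, (hd y).symm⟩
  · intro h x hx
    obtain ⟨z, hz⟩ := h _ ((hn x).1 hx)
    obtain ⟨y, rfl⟩ := (chainsIso₁ M).toLinearEquiv.surjective z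
    exact ⟨y, (chainsIso₀ M).toLinearEquiv.injective ((hd y).trans hz)⟩

/-- Flabbiness in terms of elements. The `finsum` over `S` makes the norm independent of the choice
of a `Fintype` instance on `S`. -/
theorem isFlabby_iff {G : Type} [Group G] [Finite G] {M : Type} [AddCommGroup M] [Module ℤ M]
    (ρ : Representation ℤ G M) :
    IsFlabby ρ ↔ ∀ S : Subgroup G, ∀ m : M, ∑ᶠ s : S, ρ s m = 0 →
      m ∈ Submodule.span ℤ {y | ∃ s ∈ S, ∃ x, ρ s x - x = y} := by
  refine forall_congr' fun S => ?_
  let : Fintype S := Fintype.ofFinite S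
  refine (subsingleton_tateCohomology_neg_one_iff (Rep.of (ρ.comp S.subtype))).trans ?_
  refine forall_congr' fun m => ?_
  have h1 : Representation.norm (ρ.comp S.subtype) m = ∑ᶠ s : S, ρ s m := by
    rw [finsum_eq_sum_of_fintype, Representation.norm, LinearMap.sum_apply]
    rfl
  have h2 : Representation.Coinvariants.ker (ρ.comp S.subtype) =
      Submodule.span ℤ {y | ∃ s ∈ S, ∃ x, ρ s x - x = y} := by
    refine congrArg (Submodule.span ℤ) (Set.ext fun y => ⟨?_, ?_⟩)
    · rintro ⟨⟨s, x⟩, rfl⟩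
      exact ⟨s, s.2, x, rfl⟩
    · rintro ⟨s, hs, x, rfl⟩
      exact ⟨⟨⟨s, hs⟩, x⟩, rfl⟩
  rw [← h1, ← h2]

theorem mem_of_odd_nsmul_mem {M : Type*} [AddCommGroup M] [Module ℤ M] {W : Submodule ℤ M}
    {n : ℕ} (hn : Odd n) {m : M} (h2 : 2 • m ∈ W) (h : n • m ∈ W) : m ∈ W := by
  obtain ⟨q, rfl⟩ := hn
  have := sub_mem h (nsmul_mem h2 q)
  rwa [add_nsmul, mul_nsmul, one_nsmul, add_sub_cancel_left] at this

section Dihedral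

open Classical in
/-- A sum over a subgroup of the dihedral group, split into rotations and reflections. -/
theorem finsum_subgroup_dihedralGroup {p : ℕ} [NeZero p] {M : Type*} [AddCommMonoid M]
    (S : Subgroup (DihedralGroup p))
    (f : DihedralGroup p → M) :
    ∑ᶠ s : S, f s = (∑ i : ZMod p, if r i ∈ S then f (r i) else 0) +
      ∑ i : ZMod p, if sr i ∈ S then f (sr i) else 0 := by
  have h : ∑ᶠ s : S, f s = ∑ g : DihedralGroup p, if g ∈ S then f g else 0 := by
    rw [finsum_eq_sum_of_fintype, ← Finset.sum_filter]
    exact (Finset.sum_subtype _ (by simp) f).symm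
  let e : ZMod p ⊕ ZMod p ≃ DihedralGroup p :=
    { toFun := Sum.elim r sr
      invFun := fun g => match g with
        | r i => Sum.inl i
        | sr i => Sum.inr i
      left_inv := by rintro (i | i) <;> rfl
      right_inv := by rintro (i | i) <;> rfl }
  rw [h, ← e.sum_comp, Fintype.sum_sum_type]
  rfl

variable {p : ℕ} {M : Type} [AddCommGroup M] [Module ℤ M]

theorem r_mem_zpowers (i : ZMod p) : r i ∈ Subgroup.zpowers (r 1 : DihedralGroup p) :=
  ⟨i.cast, by simp⟩

theorem sr_notMem_zpowers (i : ZMod p) : sr i ∉ Subgroup.zpowers (r 1 : DihedralGroup p) := by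
  rintro ⟨k, hk⟩
  simp at hk

theorem apply_r_mul (ρ : Representation ℤ (DihedralGroup p) M) (i j : ZMod p) (m : M) :
    ρ (r i) (ρ (r j) m) = ρ (r (i + j)) m := by
  rw [← r_mul_r, map_mul]; rfl

/-- Flabbiness tested on `⟨σ⟩`, for any submodule `W` containing `(g - 1) M` for all `g ∈ ⟨σ⟩`. -/
theorem IsFlabby.mem_of_sum_r_eq_zero [NeZero p] {ρ : Representation ℤ (DihedralGroup p) M}
    (h : IsFlabby ρ) (W : Submodule ℤ M) (hW : ∀ i x, ρ (r i) x - x ∈ W) (m : M)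
    (hm : ∑ i : ZMod p, ρ (r i) m = 0) : m ∈ W := by
  classical
  refine Submodule.span_le.2 ?_ ((isFlabby_iff ρ).1 h (Subgroup.zpowers (r 1)) m ?_)
  · rintro _ ⟨s | s, hs, x, rfl⟩
    · exact hW s x
    · exact (sr_notMem_zpowers s hs).elim
  · rw [finsum_subgroup_dihedralGroup _ fun g => ρ g m]
    simp [r_mem_zpowers, sr_notMem_zpowers, hm]

/-- Flabbiness tested on `⟨τ⟩`, for any submodule `W` containing `(τ - 1) M`. -/
theorem IsFlabby.mem_of_add_sr_eq_zero [NeZero p] {ρ : Representation ℤ (DihedralGroup p) M}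
    (h : IsFlabby ρ) (W : Submodule ℤ M) (hW : ∀ x, ρ (sr 0) x - x ∈ W) (m : M)
    (hm : m + ρ (sr 0) m = 0) : m ∈ W := by
  classical
  have hz : ∀ g : DihedralGroup p, g ∈ Subgroup.zpowers (sr 0 : DihedralGroup p) ↔
      g = 1 ∨ g = sr 0 := by
    intro g
    rw [Subgroup.mem_zpowers_iff]
    have h2 : (sr 0 : DihedralGroup p) ^ (2 : ℤ) = 1 := by
      rw [zpow_ofNat, pow_two, sr_mul_self]
    constructor
    · rintro ⟨k, rfl⟩
      obtain ⟨l, rfl | rfl⟩ := Int.even_or_odd' k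
      · left; rw [zpow_mul, h2, one_zpow]
      · right; rw [zpow_add, zpow_mul, h2, one_zpow, one_mul, zpow_one]
    · rintro (rfl | rfl)
      · exact ⟨0, rfl⟩
      · exact ⟨1, zpow_one _⟩
  refine Submodule.span_le.2 ?_ ((isFlabby_iff ρ).1 h (Subgroup.zpowers (sr 0)) m ?_)
  · rintro _ ⟨s, hs, x, rfl⟩
    obtain rfl | rfl := (hz s).1 hs
    · simp
    · exact hW x
  · rw [finsum_subgroup_dihedralGroup _ fun g => ρ g m]
    simp only [hz, one_def, r.injEq, sr.injEq, reduceCtorEq, or_false, false_or]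
    rw [Fintype.sum_ite_eq', Fintype.sum_ite_eq', ← one_def]
    simpa using hm

/-- It is enough to test flabbiness on the Sylow subgroups `⟨σ⟩` and `⟨τ⟩`. The reflections are
conjugate to `τ`; for the whole group, the transfer maps to `⟨σ⟩` and `⟨τ⟩` show that `H⁻¹` is
killed by `2` and by `p`. -/
theorem isFlabby_of_sylow [Fact p.Prime] (hp : Odd p) {ρ : Representation ℤ (DihedralGroup p) M}
    (hr : ∀ m, ∑ i : ZMod p, ρ (r i) m = 0 → ∃ n, ρ (r 1) n - n = m)
    (hs : ∀ m, m + ρ (sr 0) m = 0 → ∃ n, ρ (sr 0) n - n = m) : IsFlabby ρ := by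
  classical
  -- `sr k` is conjugate to `sr 0` because `2` is invertible modulo `p`
  have hs' : ∀ k m, m + ρ (sr k) m = 0 → ∃ n, ρ (sr k) n - n = m := by
    intro k m hm
    have h2 : (2 : ZMod p) ≠ 0 := by
      have : ((2 : ℕ) : ZMod p) ≠ 0 := by
        rw [Ne, ZMod.natCast_eq_zero_iff, Nat.prime_dvd_prime_iff_eq Fact.out Nat.prime_two]
        rintro rfl
        exact absurd hp (by decide)
      exact_mod_cast this
    obtain ⟨a, rfl⟩ : ∃ a : ZMod p, k = -a - a := ⟨-k / 2, by field_simp; ring⟩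
    have hconj : ∀ x, ρ (sr (-a - a)) x = ρ (r a) (ρ (sr 0) (ρ (r (-a)) x)) := by
      intro x
      have : (sr (-a - a) : DihedralGroup p) = r a * (sr 0 * r (-a)) := by
        simp only [sr_mul_r, r_mul_sr]; ring_nf
      rw [this, map_mul, map_mul]; rfl
    have hinv : ∀ x, ρ (r a) (ρ (r (-a)) x) = x := by
      intro x
      rw [apply_r_mul, add_neg_cancel, ← one_def, map_one]; rfl
    have hinv' : ∀ x, ρ (r (-a)) (ρ (r a) x) = x := by
      intro x
      rw [apply_r_mul, neg_add_cancel, ← one_def, map_one]; rfl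
    obtain ⟨n, hn⟩ := hs (ρ (r (-a)) m) (by
      have := congrArg (ρ (r (-a))) hm
      rwa [map_add, hconj, hinv', map_zero] at this)
    refine ⟨ρ (r a) n, ?_⟩
    rw [hconj, hinv', ← map_sub, hn, hinv]
  rw [isFlabby_iff]
  intro S m hm
  rw [finsum_subgroup_dihedralGroup _ fun g => ρ g m] at hm
  have hmem : ∀ g ∈ S, ∀ x, ρ g x - x ∈ Submodule.span ℤ {y | ∃ s ∈ S, ∃ x, ρ s x - x = y} :=
    fun g hg x => Submodule.subset_span ⟨g, hg, x, rfl⟩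
  by_cases h1 : ∃ i : ZMod p, i ≠ 0 ∧ r i ∈ S
  · obtain ⟨i, hi0, hi⟩ := h1
    have hall : ∀ j : ZMod p, r j ∈ S := by
      intro j
      have : (r j : DihedralGroup p) = r i ^ (j / i).val := by
        rw [r_pow]
        congr 1
        rw [ZMod.natCast_val, ZMod.cast_id', id, mul_div_cancel₀ _ hi0]
      rw [this]
      exact pow_mem hi _
    by_cases h2 : ∃ k : ZMod p, sr k ∈ S
    · obtain ⟨k, hk⟩ := h2
      have hall' : ∀ j : ZMod p, sr j ∈ S := by
        intro j
        have := S.mul_mem hk (hall (j - k))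
        rwa [sr_mul_r, add_sub_cancel] at this
      simp only [hall, hall', if_true] at hm
      -- `m + τ m` is killed by the norm of `⟨σ⟩`
      have hc : ∑ i : ZMod p, ρ (r i) (m + ρ (sr 0) m) = 0 := by
        rw [← hm, ← Equiv.sum_comp (Equiv.neg (ZMod p)) fun i => ρ (sr i) m,
          ← Finset.sum_add_distrib]
        refine Finset.sum_congr rfl fun i _ => ?_
        rw [map_add]
        congr 1
        rw [← Module.End.mul_apply, ← map_mul, r_mul_sr, zero_sub]
        rfl
      -- the norm of `⟨σ⟩` applied to `m` is killed by `1 + τ`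
      have hd : (∑ i : ZMod p, ρ (r i) m) + ρ (sr 0) (∑ i : ZMod p, ρ (r i) m) = 0 := by
        rw [← hm, map_sum]
        congr 1
        refine Finset.sum_congr rfl fun i _ => ?_
        rw [← Module.End.mul_apply, ← map_mul, sr_mul_r, zero_add]
      obtain ⟨n, hn⟩ := hr _ hc
      obtain ⟨n', hn'⟩ := hs _ hd
      -- `2 m` and `p m` lie in the augmentation submodule
      have e2 : 2 • m ∈ Submodule.span ℤ {y | ∃ s ∈ S, ∃ x, ρ s x - x = y} := by
        have := sub_mem (hmem (r 1) (hall 1) n) (hmem (sr 0) (hall' 0) m)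
        rw [hn] at this
        convert this using 1
        rw [two_nsmul]; abel
      have ep : p • m ∈ Submodule.span ℤ {y | ∃ s ∈ S, ∃ x, ρ s x - x = y} := by
        have h3 := sub_mem (hmem (sr 0) (hall' 0) n')
          (sum_mem (t := Finset.univ) fun i _ => hmem (r i) (hall i) m)
        rw [hn', Finset.sum_sub_distrib] at h3
        convert h3 using 1
        simp
      exact mem_of_odd_nsmul_mem hp e2 ep
    · push Not at h2
      simp only [hall, h2, if_true, if_false, Finset.sum_const_zero, add_zero] at hm
      obtain ⟨n, rfl⟩ := hr m hm
      exact hmem _ (hall 1) n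
  · push Not at h1
    have h1' : ∀ i : ZMod p, r i ∈ S ↔ i = 0 := fun i =>
      ⟨fun h => by_contra fun h0 => h1 i h0 h, fun h => by rw [h, ← one_def]; exact S.one_mem⟩
    simp only [h1'] at hm
    rw [Fintype.sum_ite_eq', ← one_def, map_one, Module.End.one_apply] at hm
    by_cases h2 : ∃ k : ZMod p, sr k ∈ S
    · obtain ⟨k, hk⟩ := h2
      have h2' : ∀ i : ZMod p, sr i ∈ S ↔ i = k := fun i => ⟨fun h => by
          have := S.mul_mem hk h
          rw [sr_mul_sr, h1', sub_eq_zero] at this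
          exact this, fun h => h ▸ hk⟩
      simp only [h2'] at hm
      rw [Fintype.sum_ite_eq'] at hm
      obtain ⟨n, rfl⟩ := hs' k m hm
      exact hmem _ hk n
    · push Not at h2
      simp only [h2, if_false, Finset.sum_const_zero, add_zero] at hm
      rw [hm]
      exact zero_mem _

end Dihedral

/-! ### Arithmetic of `ℤ[ζ]` at the prime `1 - ζ` -/

section Cyclotomic

variable {p : ℕ} {ζ : ℂ}

theorem zetaPow_sub_one_mem_idealP (i : ZMod p) : zetaPow ζ i - 1 ∈ idealP ζ := by
  rw [idealP, Ideal.mem_span_singleton, ← neg_dvd, neg_sub, zetaPow]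
  exact sub_one_dvd_pow_sub_one _ _

variable [Fact p.Prime]

open Polynomial in
theorem exists_eq_aeval_zeta (x : R ζ) : ∃ f : ℤ[X], x = aeval (zeta ζ) f := by
  have hx : (x : ℂ) ∈ Algebra.adjoin ℤ {ζ} := x.2
  rw [Algebra.adjoin_singleton_eq_range_aeval] at hx
  obtain ⟨f, hf⟩ := hx
  refine ⟨f, Subtype.ext ?_⟩
  rw [← hf]
  exact aeval_algHom_apply (R ζ).val (zeta ζ) f

open Polynomial in
/-- An inverse `f(ζ)` of `1 - ζ` would make the cyclotomic polynomial `Φ_p` divide `1 - (1 - X) f`;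
evaluating at `1`, where `Φ_p` takes the value `p`, gives `p ∣ 1`. -/
theorem not_isUnit_one_sub_zeta (hζ : IsPrimitiveRoot ζ p) : ¬ IsUnit (1 - zeta ζ) := by
  intro h
  obtain ⟨c, hc⟩ := h.exists_right_inv
  obtain ⟨f, rfl⟩ := exists_eq_aeval_zeta c
  have h0 : aeval ζ (1 - (1 - X) * f) = 0 := by
    have h1 : (1 - ζ) * aeval ζ f = 1 := by
      have h2 := congrArg (R ζ).val hc
      rwa [map_mul, map_sub, map_one, ← aeval_algHom_apply] at h2
    simp [h1]
  have hdvd := minpoly.isIntegrallyClosed_dvd (hζ.isIntegral (Fact.out : p.Prime).pos) h0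
  rw [← cyclotomic_eq_minpoly hζ (Fact.out : p.Prime).pos] at hdvd
  have h2 := eval_dvd hdvd (x := (1 : ℤ))
  rw [eval_one_cyclotomic_prime] at h2
  simp only [eval_sub, eval_one, eval_mul, eval_X, sub_self, zero_mul, sub_zero] at h2
  exact (Nat.prime_iff_prime_int.1 Fact.out).not_isUnit (isUnit_of_dvd_one h2)

open Polynomial in
/-- The residue ring `R / P` is generated by `1`. -/
theorem exists_sub_intCast_mem_idealP (x : R ζ) : ∃ n : ℤ, x - n ∈ idealP ζ := by
  obtain ⟨f, rfl⟩ := exists_eq_aeval_zeta x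
  refine ⟨f.eval 1, ?_⟩
  have h := sub_dvd_eval_sub (zeta ζ) 1 (f.map (algebraMap ℤ (R ζ)))
  rw [eval_map_algebraMap, eval_map_algebraMap, ← neg_dvd, neg_sub] at h
  have h1 : aeval (1 : R ζ) f = (f.eval 1 : ℤ) := by
    simpa using aeval_algebraMap_apply (R ζ) (1 : ℤ) f
  rwa [h1, ← Ideal.mem_span_singleton] at h

theorem zetaPow_one : zetaPow ζ (1 : ZMod p) = zeta ζ := by
  rw [zetaPow, ZMod.val_one, pow_one]

theorem one_sub_zeta_ne_zero (hζ : IsPrimitiveRoot ζ p) : 1 - zeta ζ ≠ 0 := by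
  intro h
  exact hζ.ne_one (Fact.out : p.Prime).one_lt (congrArg Subtype.val (sub_eq_zero.1 h)).symm

theorem sum_zetaPow (hζ : IsPrimitiveRoot ζ p) : ∑ i : ZMod p, zetaPow ζ i = 0 := by
  have h : (∑ i : ZMod p, zetaPow ζ i) * zeta ζ = ∑ i : ZMod p, zetaPow ζ i := by
    rw [Finset.sum_mul, ← Equiv.sum_comp (Equiv.addRight (1 : ZMod p)) fun i => zetaPow ζ i]
    refine Finset.sum_congr rfl fun i _ => ?_
    rw [Equiv.coe_addRight, zetaPow_add hζ, zetaPow_one]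
  refine (mul_eq_zero (a := 1 - zeta ζ).1 ?_).resolve_left (one_sub_zeta_ne_zero hζ)
  linear_combination -h

theorem natCast_mem_idealP (hζ : IsPrimitiveRoot ζ p) : (p : R ζ) ∈ idealP ζ := by
  have h := sum_mem (t := Finset.univ) fun (i : ZMod p) _ =>
    neg_mem (zetaPow_sub_one_mem_idealP (ζ := ζ) i)
  simpa [sum_zetaPow hζ] using h

theorem conjR_sub_self_mem_idealP (hζ : IsPrimitiveRoot ζ p) (x : R ζ) :
    conjR hζ x - x ∈ idealP ζ := by
  obtain ⟨n, hn⟩ := exists_sub_intCast_mem_idealP x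
  have h := sub_mem (idealP_stable hζ (Ideal.mem_map_of_mem (conjR hζ) hn)) hn
  simpa using h

/-- `R` contains an element of trace one over the real subring, which makes the stable ideals of `R`
cohomologically trivial for complex conjugation. -/
theorem exists_add_conjR_eq_one (hp : Odd p) (hζ : IsPrimitiveRoot ζ p) :
    ∃ x : R ζ, x + conjR hζ x = 1 := by
  -- `1 + ζ` is a unit with inverse `u`, since `ζ = (ζ ^ 2) ^ ((p + 1) / 2)`; as
  -- `(1 + ζ)⁻¹ + (1 + ζ⁻¹)⁻¹ = 1`, the element `u` has trace one.
  obtain ⟨q, hq⟩ := hp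
  have hu : (1 + zeta ζ) * ∑ i ∈ Finset.range (q + 1), (zeta ζ ^ 2) ^ i = 1 := by
    refine mul_left_cancel₀ (one_sub_zeta_ne_zero hζ) ?_
    have h1 := mul_neg_geom_sum (zeta ζ ^ 2) (q + 1)
    have h2 : (zeta ζ ^ 2) ^ (q + 1) = zeta ζ := by
      rw [← pow_mul, show 2 * (q + 1) = p + 1 by lia, pow_succ, zeta_pow hζ, one_mul]
    rw [h2] at h1
    linear_combination h1
  generalize ∑ i ∈ Finset.range (q + 1), (zeta ζ ^ 2) ^ i = u at hu
  refine ⟨u, ?_⟩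
  have hu' := congrArg (conjR hζ) hu
  rw [map_mul, map_add, map_one] at hu'
  linear_combination (1 - u - conjR hζ u) * hu + u * hu + u * zeta ζ * hu' -
    u * conjR hζ u * conjR_zeta_mul hζ

/-- An element of `R` outside `P` generates `R / P`, a field with `p` elements, as a group. -/
theorem exists_mul_sub_mem_idealP (hζ : IsPrimitiveRoot ζ p) {b : R ζ} (hb : b ∉ idealP ζ)
    (d : R ζ) : ∃ n : ℤ, d - n * b ∈ idealP ζ := by
  obtain ⟨β, hβ⟩ := exists_sub_intCast_mem_idealP b
  obtain ⟨δ, hδ⟩ := exists_sub_intCast_mem_idealP d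
  have hcop : IsCoprime (p : ℤ) β := by
    rw [(Nat.prime_iff_prime_int.1 Fact.out).coprime_iff_not_dvd]
    rintro ⟨k, rfl⟩
    refine hb ?_
    have := add_mem hβ ((idealP ζ).mul_mem_right (k : R ζ) (natCast_mem_idealP hζ))
    push_cast at this
    rwa [sub_add_cancel] at this
  obtain ⟨u, v, huv⟩ := hcop
  refine ⟨δ * v, ?_⟩
  have huv' : (u : R ζ) * p + v * β = 1 := by exact_mod_cast congrArg (Int.cast : ℤ → R ζ) huv
  have : d - ((δ * v : ℤ) : R ζ) * b = (d - δ) - δ * v * (b - β) + δ * u * p := by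
    push_cast
    linear_combination (-(δ : R ζ)) * huv'
  rw [this]
  exact add_mem (sub_mem hδ ((idealP ζ).mul_mem_left _ hβ))
    ((idealP ζ).mul_mem_left _ (natCast_mem_idealP hζ))

theorem isNoetherianRing_R (ζ : ℂ) : IsNoetherianRing (R ζ) := by
  have : Algebra.FiniteType ℤ (R ζ) :=
    (Subalgebra.fg_iff_finiteType _).1 ⟨{ζ}, by rw [Finset.coe_singleton]⟩
  exact Algebra.FiniteType.isNoetherianRing ℤ (R ζ)

theorem mem_idealP_mul_iff {I : Ideal (R ζ)} {x : R ζ} :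
    x ∈ idealP ζ * I ↔ ∃ y ∈ I, (1 - zeta ζ) * y = x :=
  Ideal.mem_span_singleton_mul

/-- The `P`-adic valuation `k` of a nonzero ideal `I`: all elements of `I` are divisible by
`(1 - ζ) ^ k`, and those divisible by `(1 - ζ) ^ (k + 1)` form `P I`. This replaces the
factorization of ideals, so that `R` need not be known to be a Dedekind domain. -/
theorem exists_valuation (hζ : IsPrimitiveRoot ζ p) {I : Ideal (R ζ)} (hI : I ≠ ⊥) :
    ∃ k : ℕ, (∀ x ∈ I, (1 - zeta ζ) ^ k ∣ x) ∧ (∃ x ∈ I, ¬ (1 - zeta ζ) ^ (k + 1) ∣ x) ∧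
      ∀ x ∈ I, x ∈ idealP ζ * I ↔ (1 - zeta ζ) ^ (k + 1) ∣ x := by
  classical
  have hex : ∃ k : ℕ, ∃ x ∈ I, ¬ (1 - zeta ζ) ^ (k + 1) ∣ x := by
    obtain ⟨x, hx, hx0⟩ := Submodule.exists_mem_ne_zero_of_ne_bot hI
    have := isNoetherianRing_R ζ
    obtain ⟨k, hk⟩ := FiniteMultiplicity.of_not_isUnit (not_isUnit_one_sub_zeta hζ) hx0
    exact ⟨k, x, hx, hk⟩
  obtain ⟨a, ha, hak⟩ := Nat.find_spec hex
  have hmin := fun m => Nat.find_min hex (m := m)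
  generalize Nat.find hex = k at *
  have hdvd : ∀ x ∈ I, (1 - zeta ζ) ^ k ∣ x := by
    intro x hx
    rcases k with _ | k
    · simp
    · by_contra hne
      exact hmin k k.lt_succ_self ⟨x, hx, hne⟩
  refine ⟨k, hdvd, ⟨a, ha, hak⟩, fun x hx => ⟨?_, ?_⟩⟩
  · intro h
    obtain ⟨y, hy, rfl⟩ := mem_idealP_mul_iff.1 h
    rw [pow_succ']
    exact mul_dvd_mul_left _ (hdvd y hy)
  · rintro ⟨c, rfl⟩
    obtain ⟨b, rfl⟩ := hdvd a ha
    have hb : b ∉ idealP ζ := by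
      rw [idealP, Ideal.mem_span_singleton]
      intro h
      exact hak (by rw [pow_succ]; exact mul_dvd_mul_left _ h)
    -- `a = (1 - ζ) ^ k * b` with `b` invertible modulo `P`, so `1 = n * b + (1 - ζ) * v`
    obtain ⟨n, hn⟩ := exists_mul_sub_mem_idealP hζ hb 1
    rw [idealP, Ideal.mem_span_singleton] at hn
    obtain ⟨v, hv⟩ := hn
    refine mem_idealP_mul_iff.2 ⟨(1 - zeta ζ) ^ k * c, ?_, by ring⟩
    have : (1 - zeta ζ) ^ k * c =
        n * c * ((1 - zeta ζ) ^ k * b) + v * ((1 - zeta ζ) ^ (k + 1) * c) := by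
      linear_combination (1 - zeta ζ) ^ k * c * hv
    rw [this]
    exact add_mem (I.mul_mem_left _ ha) (I.mul_mem_left _ hx)

theorem exists_not_mem_idealP_mul (hζ : IsPrimitiveRoot ζ p) {I : Ideal (R ζ)} (hI : I ≠ ⊥) :
    ∃ x ∈ I, x ∉ idealP ζ * I := by
  obtain ⟨k, -, ⟨x, hx, hxk⟩, h⟩ := exists_valuation hζ hI
  exact ⟨x, hx, fun hx' => hxk ((h x hx).1 hx')⟩

/-- Every element of `I` outside `P I` generates `I / P I` as a group:
this quotient has order `p`. -/
theorem exists_sub_mem_idealP_mul (hζ : IsPrimitiveRoot ζ p) {I : Ideal (R ζ)} {a : R ζ}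
    (ha : a ∈ I) (ha' : a ∉ idealP ζ * I) {x : R ζ} (hx : x ∈ I) :
    ∃ n : ℤ, x - n * a ∈ idealP ζ * I := by
  have hI : I ≠ ⊥ := by
    rintro rfl
    rw [Ideal.mem_bot] at ha
    exact ha' (ha ▸ zero_mem _)
  obtain ⟨k, hk, -, h⟩ := exists_valuation hζ hI
  rw [h a ha] at ha'
  obtain ⟨b, rfl⟩ := hk a ha
  obtain ⟨d, rfl⟩ := hk x hx
  obtain ⟨n, hn⟩ := exists_mul_sub_mem_idealP hζ (b := b) (by
    rw [idealP, Ideal.mem_span_singleton]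
    intro h
    exact ha' (by rw [pow_succ]; exact mul_dvd_mul_left _ h)) d
  refine ⟨n, (h _ (sub_mem hx (I.mul_mem_left _ ha))).2 ?_⟩
  rw [idealP, Ideal.mem_span_singleton] at hn
  rw [pow_succ]
  convert mul_dvd_mul_left ((1 - zeta ζ) ^ k) hn using 1
  ring

/-- Complex conjugation acts trivially on `RA / P RA`, because `RA` is generated by elements
of `R₀`. -/
theorem conjR_sub_self_mem (hζ : IsPrimitiveRoot ζ p) (A : Ideal (R₀ ζ)) {x : R ζ}
    (hx : x ∈ extendIdeal hζ A) : conjR hζ x - x ∈ idealP ζ * extendIdeal hζ A := by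
  have hx' := hx
  rw [extendIdeal, Ideal.map] at hx'
  induction hx' using Submodule.span_induction with
  | mem x h =>
    obtain ⟨a, -, rfl⟩ := h
    rw [conjR_incl, sub_self]
    exact zero_mem _
  | zero => simp
  | add x y hx' hy' h1 h2 =>
    rw [map_add, add_sub_add_comm]
    exact add_mem (h1 hx') (h2 hy')
  | smul c x hx' h1 =>
    have : conjR hζ (c • x) - c • x = conjR hζ c * (conjR hζ x - x) + (conjR hζ c - c) * x := by
      rw [smul_eq_mul, map_mul]; ring
    rw [this]
    exact add_mem (Ideal.mul_mem_left _ _ (h1 hx'))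
      (Ideal.mul_mem_mul (conjR_sub_self_mem_idealP hζ c) hx')

/-- Complex conjugation acts as `-1` on `P / P ^ 2`. -/
theorem conjR_add_self_mem (hζ : IsPrimitiveRoot ζ p) {x : R ζ} (hx : x ∈ idealP ζ) :
    conjR hζ x + x ∈ idealP ζ * idealP ζ := by
  rw [idealP, Ideal.mem_span_singleton'] at hx
  obtain ⟨c, rfl⟩ := hx
  refine mem_idealP_mul_iff.2
    ⟨-(conjR hζ c - c) - conjR hζ c * (conjR hζ (zeta ζ) - 1), ?_, ?_⟩
  · refine sub_mem (neg_mem (conjR_sub_self_mem_idealP hζ c)) (Ideal.mul_mem_left _ _ ?_)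
    have h := idealP_stable hζ (Ideal.mem_map_of_mem (conjR hζ)
      (Ideal.mem_span_singleton_self (1 - zeta ζ)))
    simpa using neg_mem h
  · rw [map_mul, map_sub, map_one]
    linear_combination conjR hζ c * conjR_zeta_mul hζ

theorem extendIdeal_ne_bot (hζ : IsPrimitiveRoot ζ p) {A : Ideal (R₀ ζ)} (hA : A ≠ ⊥) :
    extendIdeal hζ A ≠ ⊥ := by
  rw [extendIdeal, Ne, Ideal.map_eq_bot_iff_of_injective]
  · exact hA
  · intro x y h
    exact Subtype.ext (by rw [← coe_incl hζ, h, coe_incl])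

theorem idealP_ne_bot (hζ : IsPrimitiveRoot ζ p) : idealP ζ ≠ ⊥ := by
  rw [idealP, Ne, Ideal.span_singleton_eq_bot]
  exact one_sub_zeta_ne_zero hζ

end Cyclotomic

/-! ### Representations of the dihedral group and their extensions -/

section Extensions

variable {p : ℕ}

/-- The dihedral group is generated by `σ` and `τ`, as a monoid since it is finite. -/
theorem dihedralGroup_induction [NeZero p] {P : DihedralGroup p → Prop} (hr : P (r 1))
    (hs : P (sr 0)) (hmul : ∀ g h, P g → P h → P (g * h)) (g : DihedralGroup p) : P g := by
  have h1 : P 1 := by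
    rw [← sr_mul_self (0 : ZMod p)]
    exact hmul _ _ hs hs
  have hn : ∀ n : ℕ, P (r 1 ^ n) := by
    intro n
    induction n with
    | zero => rwa [pow_zero]
    | succ n ih =>
      rw [pow_succ]
      exact hmul _ _ ih hr
  have hri : ∀ i : ZMod p, P (r i) := by
    intro i
    have := hn i.val
    rwa [r_one_pow, ZMod.natCast_val, ZMod.cast_id', id] at this
  rcases g with i | i
  · exact hri i
  · have := hmul _ _ hs (hri i)
    rwa [sr_mul_r, zero_add] at this

section Representation

variable {A B M : Type*} [AddCommGroup A] [Module ℤ A] [AddCommGroup B] [Module ℤ B]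
  [AddCommGroup M] [Module ℤ M] {α : Representation ℤ (DihedralGroup p) A}
  {β : Representation ℤ (DihedralGroup p) B} {ρ : Representation ℤ (DihedralGroup p) M}

theorem apply_sr_sr (ρ : Representation ℤ (DihedralGroup p) M) (m : M) :
    ρ (sr 0) (ρ (sr 0) m) = m := by
  rw [← Module.End.mul_apply, ← map_mul, sr_mul_self, map_one, Module.End.one_apply]

/-- The relation `σ τ σ = τ`. -/
theorem apply_r_sr_r (ρ : Representation ℤ (DihedralGroup p) M) (m : M) :
    ρ (r 1) (ρ (sr 0) (ρ (r 1) m)) = ρ (sr 0) m := by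
  rw [← Module.End.mul_apply, ← Module.End.mul_apply, ← map_mul, ← map_mul, r_mul_sr, sr_mul_r]
  simp

/-- The submodule `(σ - 1) M` of a representation `M` of the dihedral group. -/
def sigmaRange (ρ : Representation ℤ (DihedralGroup p) M) : Submodule ℤ M :=
  LinearMap.range (ρ (r 1) - LinearMap.id)

theorem mem_sigmaRange {m : M} : m ∈ sigmaRange ρ ↔ ∃ n, ρ (r 1) n - n = m := Iff.rfl

theorem sub_mem_sigmaRange (m : M) : ρ (r 1) m - m ∈ sigmaRange ρ := ⟨m, rfl⟩

theorem apply_sr_mem_sigmaRange {m : M} (hm : m ∈ sigmaRange ρ) :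
    ρ (sr 0) m ∈ sigmaRange ρ := by
  obtain ⟨n, rfl⟩ := hm
  refine ⟨-ρ (sr 0) (ρ (r 1) n), ?_⟩
  simp only [LinearMap.sub_apply, LinearMap.id_apply, map_neg, map_sub, apply_r_sr_r]
  abel

theorem apply_r_sub_mem_sigmaRange [NeZero p] (i : ZMod p) (m : M) :
    ρ (r i) m - m ∈ sigmaRange ρ := by
  have hn : ∀ n : ℕ, ρ (r 1 ^ n) m - m ∈ sigmaRange ρ := by
    intro n
    induction n with
    | zero => rw [pow_zero, map_one, Module.End.one_apply, sub_self]; exact zero_mem _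
    | succ n ih =>
      rw [pow_succ', map_mul, Module.End.mul_apply]
      have := add_mem (sub_mem_sigmaRange (ρ := ρ) (ρ (r 1 ^ n) m)) ih
      rwa [sub_add_sub_cancel] at this
  have := hn i.val
  rwa [r_one_pow, ZMod.natCast_val, ZMod.cast_id', id] at this

theorem map_sigmaRange (f : Representation.IntertwiningMap α ρ) {a : A}
    (ha : a ∈ sigmaRange α) : f a ∈ sigmaRange ρ := by
  obtain ⟨b, rfl⟩ := mem_sigmaRange.1 ha
  rw [map_sub, f.isIntertwining]
  exact sub_mem_sigmaRange _

/-- A linear map commuting with `σ` and `τ` is a map of representations. -/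
theorem map_apply_of_generators [NeZero p] (s : B →ₗ[ℤ] M)
    (hr : ∀ b, s (β (r 1) b) = ρ (r 1) (s b)) (hs : ∀ b, s (β (sr 0) b) = ρ (sr 0) (s b)) :
    ∀ g b, s (β g b) = ρ g (s b) := by
  intro g
  induction g using dihedralGroup_induction with
  | hr => exact hr
  | hs => exact hs
  | hmul g h hg hh =>
    intro b
    rw [map_mul, map_mul, Module.End.mul_apply, Module.End.mul_apply, hg, hh]

/-- The Tate group `H⁻¹(⟨τ⟩, M)` vanishes: every `m` with `m + τ m = 0` is of the form
`τ n - n`. -/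
def TauExact (ρ : Representation ℤ (DihedralGroup p) M) : Prop :=
  ∀ m, m + ρ (sr 0) m = 0 → ∃ n, ρ (sr 0) n - n = m

/-- `(σ - 1) A` is a maximal subgroup of `A`. For a stable nonzero ideal of `R` this says that
`H⁻¹(⟨σ⟩, A)` has prime order. -/
def SigmaMaximal (α : Representation ℤ (DihedralGroup p) A) : Prop :=
  IsCoatom (sigmaRange α)

theorem TauExact.of_exact (hα : TauExact α) (hβ : TauExact β)
    (f : Representation.IntertwiningMap α ρ) (g : Representation.IntertwiningMap ρ β)
    (hf : Function.Injective f) (hfg : Function.Exact f g) (hg : Function.Surjective g) :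
    TauExact ρ := by
  intro m hm
  obtain ⟨b, hb⟩ := hβ (g m) (by rw [← g.isIntertwining, ← map_add, hm, map_zero])
  obtain ⟨n, rfl⟩ := hg b
  obtain ⟨a, ha⟩ := (hfg (m - (ρ (sr 0) n - n))).1 (by
    rw [map_sub, map_sub, g.isIntertwining, hb, sub_self])
  obtain ⟨a', ha'⟩ := hα a (hf (by
    rw [map_add, f.isIntertwining, ha, map_zero, map_sub, map_sub, apply_sr_sr, ← hm]
    abel))
  refine ⟨n + f a', ?_⟩
  rw [map_add, ← f.isIntertwining, ← sub_add_cancel m (ρ (sr 0) n - n), ← ha, ← ha', map_sub]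
  abel

end Representation

/-- Let `σ` act trivially on the torsion-free module `B`. In an extension of `B` by `A`, elements
killed by the norm of `⟨σ⟩` come from `A`, so the condition on `⟨σ⟩` is that `A ⊆ (σ - 1) M`. -/
theorem isFlabby_of_extension [Fact p.Prime] (hp : Odd p) {A B : Type*} {M : Type}
    [AddCommGroup A] [Module ℤ A] [AddCommGroup B] [Module ℤ B] [IsAddTorsionFree B]
    [AddCommGroup M] [Module ℤ M] {α : Representation ℤ (DihedralGroup p) A}
    {β : Representation ℤ (DihedralGroup p) B} {ρ : Representation ℤ (DihedralGroup p) M}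
    (hα : TauExact α) (hβ : TauExact β) (hβr : ∀ i b, β (r i) b = b)
    (f : Representation.IntertwiningMap α ρ) (g : Representation.IntertwiningMap ρ β)
    (hf : Function.Injective f) (hfg : Function.Exact f g) (hg : Function.Surjective g)
    (h : ∀ a, f a ∈ sigmaRange ρ) : IsFlabby ρ := by
  refine isFlabby_of_sylow hp (fun m hm => ?_) (hα.of_exact hβ f g hf hfg hg)
  have h0 : g m = 0 := by
    have h1 := congrArg g hm
    simp only [map_sum, g.isIntertwining, hβr, map_zero, Finset.sum_const, Finset.card_univ,
      ZMod.card] at h1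
    exact (nsmul_eq_zero_iff_right (Fact.out : p.Prime).ne_zero).1 h1
  obtain ⟨a, rfl⟩ := (hfg m).1 h0
  exact h a

/-! ### The permutation lattice `ℤ[H]` -/

section Perm

/-- The cosets of `⟨σ⟩`, a basis of the permutation lattice `ℤ[H]`. -/
abbrev SigmaCosets (p : ℕ) : Type :=
  DihedralGroup p ⧸ Subgroup.zpowers (r 1 : DihedralGroup p)

/-- The basis vector of `ℤ[H]` given by the coset `⟨σ⟩`. -/
def permBase (p : ℕ) : MonoidAlgebra ℤ (SigmaCosets p) :=
  MonoidAlgebra.single ((1 : DihedralGroup p) : SigmaCosets p) 1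

theorem permLattice_sr_base : permLattice p (sr 0) (permBase p) =
    MonoidAlgebra.single ((sr 0 : DihedralGroup p) : SigmaCosets p) 1 := by
  rw [permBase, Representation.ofMulAction_single, MulAction.Quotient.smul_coe, smul_eq_mul,
    mul_one]

/-- The base vector and its image under `τ` span `ℤ[H]`. -/
theorem mem_of_permBase_mem (T : Submodule ℤ (MonoidAlgebra ℤ (SigmaCosets p)))
    (h0 : permBase p ∈ T) (h1 : permLattice p (sr 0) (permBase p) ∈ T)
    (b : MonoidAlgebra ℤ (SigmaCosets p)) : b ∈ T := by
  rw [permLattice_sr_base] at h1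
  induction b using MonoidAlgebra.induction_linear with
  | zero => exact zero_mem _
  | add x y hx hy => exact add_mem hx hy
  | single q n =>
    have : MonoidAlgebra.single q n = n • MonoidAlgebra.single q (1 : ℤ) := by simp
    rw [this]
    refine T.smul_mem n ?_
    induction q using QuotientGroup.induction_on with
    | H g =>
      rcases g with i | i
      · rwa [show ((r i : DihedralGroup p) : SigmaCosets p) = (1 : DihedralGroup p) from
          (QuotientGroup.eq.2 (by simpa using r_mem_zpowers i)).symm]
      · rwa [show ((sr i : DihedralGroup p) : SigmaCosets p) = (sr 0 : DihedralGroup p) from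
          QuotientGroup.eq.2 (by simpa using r_mem_zpowers _)]

theorem isAddTorsionFree_perm : IsAddTorsionFree (MonoidAlgebra ℤ (SigmaCosets p)) :=
  Function.Injective.isAddTorsionFree
    (MonoidAlgebra.coeffLinearEquiv ℤ : _ ≃ₗ[ℤ] (SigmaCosets p →₀ ℤ)).toAddMonoidHom
    (MonoidAlgebra.coeffLinearEquiv ℤ).injective

theorem permLattice_r (i : ZMod p) (b : MonoidAlgebra ℤ (SigmaCosets p)) :
    permLattice p (r i) b = b := by
  refine mem_of_permBase_mem (LinearMap.eqLocus (permLattice p (r i)) LinearMap.id) ?_ ?_ b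
  · rw [LinearMap.mem_eqLocus, permBase, Representation.ofMulAction_single]
    congr 1
    exact (QuotientGroup.eq.2 (by simpa using r_mem_zpowers i)).symm
  · rw [LinearMap.mem_eqLocus, permLattice_sr_base, Representation.ofMulAction_single]
    congr 1
    exact QuotientGroup.eq.2 (by simpa using r_mem_zpowers _)

/-- The base vector and its image under `τ` are linearly independent: a linear map on `ℤ[H]` takes
prescribed values on them. -/
theorem exists_linearMap_permBase {M : Type*} [AddCommGroup M] [hM : Module ℤ M] (v w : M) :
    ∃ s : MonoidAlgebra ℤ (SigmaCosets p) →ₗ[ℤ] M,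
      s (permBase p) = v ∧ s (permLattice p (sr 0) (permBase p)) = w := by
  classical
  let c : SigmaCosets p → M := fun q => if q = (1 : DihedralGroup p) then v else w
  refine ⟨Finsupp.linearCombination ℤ c ∘ₗ (MonoidAlgebra.coeffLinearEquiv ℤ).toLinearMap, ?_, ?_⟩
  · simp only [permBase, c, LinearMap.comp_apply, LinearEquiv.coe_coe,
      MonoidAlgebra.coeffLinearEquiv_apply, MonoidAlgebra.coeff_single,
      Finsupp.linearCombination_single, if_true]
    exact hM.one_smul v
  · have : ((sr 0 : DihedralGroup p) : SigmaCosets p) ≠ (1 : DihedralGroup p) := by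
      intro h
      refine sr_notMem_zpowers (0 : ZMod p) ?_
      simpa using QuotientGroup.eq.1 h
    rw [permLattice_sr_base]
    simp only [c, LinearMap.comp_apply, LinearEquiv.coe_coe, this,
      MonoidAlgebra.coeffLinearEquiv_apply, MonoidAlgebra.coeff_single,
      Finsupp.linearCombination_single, if_false]
    exact hM.one_smul w

theorem tauExact_permLattice : TauExact (permLattice p) := by
  intro b hb
  obtain ⟨m, n, rfl⟩ : ∃ m n : ℤ, m • permBase p + n • permLattice p (sr 0) (permBase p) = b :=
    Submodule.mem_span_pair.1 (mem_of_permBase_mem (Submodule.span ℤ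
      {permBase p, permLattice p (sr 0) (permBase p)})
      (Submodule.subset_span (by simp)) (Submodule.subset_span (by simp)) b)
  obtain ⟨s, h0, h1⟩ := exists_linearMap_permBase (p := p) (1 : ℤ) 0
  have h2 := congrArg s hb
  simp only [map_add, map_smul, apply_sr_sr, h0, h1, map_zero] at h2
  obtain rfl : n = -m := by simp at h2; lia
  refine ⟨-m • permBase p, ?_⟩
  simp only [map_smul]
  module

end Perm

end Extensions

/-! ### Splitting and decomposing extensions -/

section Extensions

variable {p : ℕ}

section Split

variable {A B M : Type*} [AddCommGroup A] [Module ℤ A] [AddCommGroup B] [Module ℤ B]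
  [AddCommGroup M] [Module ℤ M] {α : Representation ℤ (DihedralGroup p) A}
  {β : Representation ℤ (DihedralGroup p) B} {ρ : Representation ℤ (DihedralGroup p) M}

theorem apply_r_sr_eq_self {v : M} (hv : ρ (r 1) v = v) :
    ρ (r 1) (ρ (sr 0) v) = ρ (sr 0) v := by
  conv_lhs => rw [← hv]
  exact apply_r_sr_r ρ v

/-- Let `(σ - 1) A` be maximal in `A`. If some `v` cannot be changed by an element of `A` to become
`σ`-invariant, then `σ v - v` is an element of `A` outside `(σ - 1) A`, and so
`A ⊆ (σ - 1) M`. -/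
theorem mem_sigmaRange_of_forall_ne
    (hα : SigmaMaximal α) (hβr : ∀ i b, β (r i) b = b)
    (f : Representation.IntertwiningMap α ρ) (g : Representation.IntertwiningMap ρ β)
    (hfg : Function.Exact f g) {v : M}
    (hv : ∀ v', g v' = g v → ρ (r 1) v' ≠ v') (a : A) : f a ∈ sigmaRange ρ := by
  obtain ⟨a₀, ha₀⟩ := (hfg (ρ (r 1) v - v)).1 (by
    rw [map_sub, g.isIntertwining, hβr, sub_self])
  have hle : sigmaRange α ≤ (sigmaRange ρ).comap f.toLinearMap := fun a ha => map_sigmaRange f ha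
  rcases hα.le_iff.1 hle with h | h
  · exact h.ge (Submodule.mem_top (x := a))
  · have hmem : a₀ ∈ (sigmaRange ρ).comap f.toLinearMap := by
      change f a₀ ∈ sigmaRange ρ
      rw [ha₀]
      exact sub_mem_sigmaRange v
    rw [h] at hmem
    obtain ⟨y, rfl⟩ := mem_sigmaRange.1 hmem
    refine absurd ?_ (hv (v - f y) ?_)
    · rw [map_sub, f.isIntertwining] at ha₀
      rw [map_sub]
      exact sub_eq_sub_iff_sub_eq_sub.2 ha₀.symm
    · rw [map_sub, (hfg (f y)).2 ⟨y, rfl⟩, sub_zero]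

variable [NeZero p]

/-- A `σ`-invariant lift `v` of `1` splits an extension of `ℤ` by `A`, provided that `A` has no
`σ`-invariants: then `τ v - v`, a `σ`-invariant element of `A`, is zero. -/
theorem exists_section_trivLattice (hα : ∀ a, α (r 1) a = a → a = 0)
    (f : Representation.IntertwiningMap α ρ) (g : Representation.IntertwiningMap ρ (trivLattice p))
    (hf : Function.Injective f) (hfg : Function.Exact f g) {v : M} (hgv : g v = 1)
    (hv : ρ (r 1) v = v) :
    ∃ s : Representation.IntertwiningMap (trivLattice p) ρ, ∀ b, g (s b) = b := by
  have hτ : ρ (sr 0) v = v := by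
    obtain ⟨a, ha⟩ := (hfg (ρ (sr 0) v - v)).1 (by
      rw [map_sub, g.isIntertwining, Representation.trivial_apply, sub_self])
    have h0 : a = 0 := hα a (hf (by
      rw [f.isIntertwining, ha, map_sub, apply_r_sr_eq_self hv, hv]))
    rw [h0, map_zero] at ha
    exact (sub_eq_zero.1 ha.symm)
  let s : ℤ →ₗ[ℤ] M := LinearMap.toSpanSingleton ℤ M v
  have hs : s 1 = v := LinearMap.toSpanSingleton_apply_one ℤ M v
  refine ⟨s.intertwiningMap_of_isIntertwiningMap _ _ (map_apply_of_generators s ?_ ?_), ?_⟩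
  · exact LinearMap.congr_fun (f := s) (g := ρ (r 1) ∘ₗ s)
      (LinearMap.ext_ring (by rw [LinearMap.comp_apply, hs, hv]))
  · exact LinearMap.congr_fun (f := s) (g := ρ (sr 0) ∘ₗ s)
      (LinearMap.ext_ring (by rw [LinearMap.comp_apply, hs, hτ]))
  · exact LinearMap.congr_fun (f := g.toLinearMap ∘ₗ s) (g := LinearMap.id)
      (LinearMap.ext_ring (by rw [LinearMap.comp_apply, hs]; exact hgv))

/-- A `σ`-invariant lift of the base vector splits an extension of `ℤ[H]`. -/
theorem exists_section_permLattice
    (g : Representation.IntertwiningMap ρ (permLattice p)) {v : M} (hgv : g v = permBase p)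
    (hv : ρ (r 1) v = v) :
    ∃ s : Representation.IntertwiningMap (permLattice p) ρ, ∀ b, g (s b) = b := by
  obtain ⟨s, h0, h1⟩ := exists_linearMap_permBase (p := p) v (ρ (sr 0) v)
  refine ⟨s.intertwiningMap_of_isIntertwiningMap _ _ (map_apply_of_generators s ?_ ?_), ?_⟩
  · refine mem_of_permBase_mem (LinearMap.eqLocus (s ∘ₗ permLattice p (r 1)) (ρ (r 1) ∘ₗ s)) ?_ ?_
    · rw [LinearMap.mem_eqLocus, LinearMap.comp_apply, LinearMap.comp_apply, permLattice_r, h0, hv]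
    · rw [LinearMap.mem_eqLocus, LinearMap.comp_apply, LinearMap.comp_apply, permLattice_r, h1,
        apply_r_sr_eq_self hv]
  · refine mem_of_permBase_mem (LinearMap.eqLocus (s ∘ₗ permLattice p (sr 0)) (ρ (sr 0) ∘ₗ s)) ?_ ?_
    · rw [LinearMap.mem_eqLocus, LinearMap.comp_apply, LinearMap.comp_apply, h1, h0]
    · rw [LinearMap.mem_eqLocus, LinearMap.comp_apply, LinearMap.comp_apply, apply_sr_sr, h1, h0,
        apply_sr_sr]
  · refine mem_of_permBase_mem (LinearMap.eqLocus (g.toLinearMap ∘ₗ s) LinearMap.id) ?_ ?_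
    · rw [LinearMap.mem_eqLocus, LinearMap.comp_apply, h0]
      exact hgv
    · rw [LinearMap.mem_eqLocus, LinearMap.comp_apply, h1]
      exact (g.isIntertwining _ _ _ _).trans (congrArg _ hgv)

/-- Let `M` be an extension of `ℤ[H]` by `A₁ ⊕ A₂`, and let `v` lift the base vector. If
`σ v - v ∈ A₁`, then `A₁`, `v` and `τ v` span a complement of `A₂`, so that `M` decomposes. -/
theorem not_isIndecomposable_of_apply_sub_mem {A₁ A₂ : Type*} [AddCommGroup A₁] [Module ℤ A₁]
    [AddCommGroup A₂] [Module ℤ A₂] [Nontrivial A₂] {α₁ : Representation ℤ (DihedralGroup p) A₁}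
    {α₂ : Representation ℤ (DihedralGroup p) A₂}
    (f₁ : Representation.IntertwiningMap α₁ ρ) (f₂ : Representation.IntertwiningMap α₂ ρ)
    (g : Representation.IntertwiningMap ρ (permLattice p))
    (hf : ∀ a₁ a₂, f₁ a₁ = f₂ a₂ → a₁ = 0 ∧ a₂ = 0)
    (hfg : ∀ m, g m = 0 ↔ ∃ a₁ a₂, f₁ a₁ + f₂ a₂ = m) {v : M} (hgv : g v = permBase p)
    (hv : ∃ a, f₁ a = ρ (r 1) v - v) : ¬ IsIndecomposable ρ := by
  obtain ⟨s, h0, h1⟩ := exists_linearMap_permBase (p := p) v (ρ (sr 0) v)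
  have hgs : ∀ b, g (s b) = b := by
    refine mem_of_permBase_mem (LinearMap.eqLocus (g.toLinearMap ∘ₗ s) LinearMap.id) ?_ ?_
    · rw [LinearMap.mem_eqLocus, LinearMap.comp_apply, h0]
      exact hgv
    · rw [LinearMap.mem_eqLocus, LinearMap.comp_apply, h1]
      exact (g.isIntertwining _ _ _ _).trans (congrArg _ hgv)
  have hg₁ : ∀ a, g (f₁ a) = 0 := fun a => (hfg _).2 ⟨a, 0, by rw [map_zero, add_zero]⟩
  have hg₂ : ∀ a, g (f₂ a) = 0 := fun a => (hfg _).2 ⟨0, a, by rw [map_zero, zero_add]⟩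
  let N : Submodule ℤ M := LinearMap.range f₁.toLinearMap ⊔ LinearMap.range s
  have hN : ∀ m, m ∈ N ↔ ∃ a b, f₁ a + s b = m := by
    intro m
    rw [Submodule.mem_sup]
    constructor
    · rintro ⟨_, ⟨a, rfl⟩, _, ⟨b, rfl⟩, rfl⟩
      exact ⟨a, b, rfl⟩
    · rintro ⟨a, b, rfl⟩
      exact ⟨_, ⟨a, rfl⟩, _, ⟨b, rfl⟩, rfl⟩
  have hfN : ∀ a, f₁ a ∈ N := fun a => (hN _).2 ⟨a, 0, by rw [map_zero, add_zero]⟩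
  have hsN : ∀ b, s b ∈ N := fun b => (hN _).2 ⟨0, b, by rw [map_zero, zero_add]⟩
  have hvN : v ∈ N := h0 ▸ hsN _
  have hwN : ρ (sr 0) v ∈ N := h1 ▸ hsN _
  have hstable : ∀ γ : DihedralGroup p, (∀ b, ρ γ (s b) ∈ N) → ∀ m ∈ N, ρ γ m ∈ N := by
    intro γ hγ m hm
    obtain ⟨a, b, rfl⟩ := (hN m).1 hm
    rw [map_add, ← f₁.isIntertwining]
    exact add_mem (hfN _) (hγ b)
  have hstab : ∀ (γ : DihedralGroup p), ∀ m ∈ N, ρ γ m ∈ N := by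
    intro γ
    induction γ using dihedralGroup_induction with
    | hr =>
      refine hstable _ (mem_of_permBase_mem (N.comap (ρ (r 1) ∘ₗ s)) ?_ ?_)
      · obtain ⟨a, ha⟩ := hv
        change ρ (r 1) (s _) ∈ N
        rw [h0, ← sub_add_cancel (ρ (r 1) v) v, ← ha]
        exact add_mem (hfN _) hvN
      · obtain ⟨a, ha⟩ := hv
        change ρ (r 1) (s _) ∈ N
        have h2 : ρ (r 1) (ρ (sr 0) v) =
            ρ (sr 0) v - f₁ (α₁ (r 1) (α₁ (sr 0) a)) := by
          rw [f₁.isIntertwining, f₁.isIntertwining, ha, map_sub, map_sub, apply_r_sr_r,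
            sub_sub_cancel]
        rw [h1, h2]
        exact sub_mem hwN (hfN _)
    | hs =>
      refine hstable _ (mem_of_permBase_mem (N.comap (ρ (sr 0) ∘ₗ s)) ?_ ?_)
      · change ρ (sr 0) (s _) ∈ N
        rwa [h0]
      · change ρ (sr 0) (s _) ∈ N
        rwa [h1, apply_sr_sr]
    | hmul g h hg hh =>
      intro m hm
      rw [map_mul, Module.End.mul_apply]
      exact hg _ (hh _ hm)
  intro hind
  have hcompl : IsCompl (⟨N, hstab⟩ : Subrepresentation ρ) f₂.range := by
    constructor
    · rw [disjoint_iff]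
      refine SetLike.ext fun m => ⟨?_, ?_⟩
      · rintro ⟨h2, h3⟩
        obtain ⟨a, b, rfl⟩ := (hN m).1 h2
        obtain ⟨a₂, ha₂⟩ : ∃ a₂, f₂ a₂ = f₁ a + s b := h3
        have hb := congrArg g ha₂
        rw [map_add, hg₁, hg₂, hgs, zero_add] at hb
        rw [← hb, map_zero, add_zero] at ha₂ ⊢
        rw [(hf _ _ ha₂.symm).1, map_zero]
        exact zero_mem (⊥ : Submodule ℤ M)
      · intro h
        obtain rfl : m = 0 := (Submodule.mem_bot ℤ).1 h
        exact ⟨N.zero_mem, f₂.range.toSubmodule.zero_mem⟩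
    · rw [codisjoint_iff]
      refine SetLike.ext fun m => ⟨fun _ => Submodule.mem_top (R := ℤ), fun _ => ?_⟩
      obtain ⟨a₁, a₂, h2⟩ := (hfg (m - s (g m))).1 (by rw [map_sub, hgs, sub_self])
      refine Submodule.mem_sup.2 ⟨f₁ a₁ + s (g m), (hN _).2 ⟨_, _, rfl⟩, f₂ a₂, ⟨a₂, rfl⟩, ?_⟩
      rw [add_right_comm, h2, sub_add_cancel]
  rcases hind.2 _ _ hcompl with h | h
  · have h2 : v ∈ (⟨N, hstab⟩ : Subrepresentation ρ) := hvN
    rw [h] at h2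
    obtain rfl : v = 0 := (Submodule.mem_bot ℤ).1 h2
    obtain ⟨t, h3, -⟩ := exists_linearMap_permBase (p := p) (1 : ℤ) 0
    rw [← hgv, map_zero, map_zero] at h3
    exact zero_ne_one h3
  · obtain ⟨a, ha⟩ := exists_ne (0 : A₂)
    have h2 : f₂ a ∈ f₂.range := ⟨a, rfl⟩
    rw [h] at h2
    have h3 : f₂ a = 0 := (Submodule.mem_bot ℤ).1 h2
    exact ha (hf 0 a (by rw [map_zero, h3])).2

end Split

end Extensions

/-! ### Extensions by two summands -/

section IndecomposableExtension

variable {p : ℕ} [Fact p.Prime]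

theorem TauExact.prod {p : ℕ} {A₁ A₂ : Type*} [AddCommGroup A₁]
    [AddCommGroup A₂] {α₁ : Representation ℤ (DihedralGroup p) A₁}
    {α₂ : Representation ℤ (DihedralGroup p) A₂} (h₁ : TauExact α₁) (h₂ : TauExact α₂) :
    TauExact (α₁.prod α₂) := by
  rintro ⟨a₁, a₂⟩ h
  obtain ⟨n₁, hn₁⟩ := h₁ a₁ (congrArg Prod.fst h)
  obtain ⟨n₂, hn₂⟩ := h₂ a₂ (congrArg Prod.snd h)
  exact ⟨(n₁, n₂), Prod.ext hn₁ hn₂⟩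

theorem SigmaMaximal.nontrivial {p : ℕ} {A : Type*} [AddCommGroup A] [Module ℤ A]
    {α : Representation ℤ (DihedralGroup p) A} (h : SigmaMaximal α) : Nontrivial A := by
  by_contra hA
  have := not_nontrivial_iff_subsingleton.1 hA
  exact h.1 (Subsingleton.elim _ _)

/-- An indecomposable extension of `ℤ[H]` by `A₁ ⊕ A₂` is flabby if both `(σ - 1) Aᵢ` are maximal
and `τ` acts as `1` on `A₁ / (σ - 1) A₁` and as `-1` on `A₂ / (σ - 1) A₂`. Let `v` lift the base
vector and `σ v - v = (a₁, a₂)`. Since the signs of `τ` differ and `p` is odd, both `a₁` and `a₂`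
lie in `(σ - 1) M`. Indecomposability gives `aᵢ ∉ (σ - 1) Aᵢ`, so `(σ - 1) M` contains `A₁`
and `A₂`. -/
theorem isFlabby_of_isIndecomposable (hp : Odd p) {A₁ A₂ : Type*} {M : Type} [AddCommGroup A₁]
    [AddCommGroup A₂] [AddCommGroup M] [Module ℤ M]
    {α₁ : Representation ℤ (DihedralGroup p) A₁} {α₂ : Representation ℤ (DihedralGroup p) A₂}
    {ρ : Representation ℤ (DihedralGroup p) M}
    (hα₁ : SigmaMaximal α₁) (hα₂ : SigmaMaximal α₂) (hτ₁ : TauExact α₁) (hτ₂ : TauExact α₂)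
    (hN₁ : ∀ a, ∑ i : ZMod p, α₁ (r i) a = 0)
    (h₁ : ∀ a, α₁ (sr 0) a - a ∈ sigmaRange α₁) (h₂ : ∀ a, α₂ (sr 0) a + a ∈ sigmaRange α₂)
    (f : Representation.IntertwiningMap (α₁.prod α₂) ρ)
    (g : Representation.IntertwiningMap ρ (permLattice p))
    (hf : Function.Injective f) (hfg : Function.Exact f g) (hg : Function.Surjective g)
    (hρ : IsIndecomposable ρ) : IsFlabby ρ := by
  let f₁ : Representation.IntertwiningMap α₁ ρ :=
    (f.toLinearMap ∘ₗ LinearMap.inl ℤ A₁ A₂).intertwiningMap_of_isIntertwiningMap _ _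
      fun γ a => by
        refine Eq.trans ?_ (f.isIntertwining _ _ γ (a, 0))
        exact congrArg f (Prod.ext rfl (map_zero (α₂ γ)).symm)
  let f₂ : Representation.IntertwiningMap α₂ ρ :=
    (f.toLinearMap ∘ₗ LinearMap.inr ℤ A₁ A₂).intertwiningMap_of_isIntertwiningMap _ _
      fun γ a => by
        refine Eq.trans ?_ (f.isIntertwining _ _ γ (0, a))
        exact congrArg f (Prod.ext (map_zero (α₁ γ)).symm rfl)
  have hf₁₂ : ∀ a₁ a₂, f (a₁, a₂) = f₁ a₁ + f₂ a₂ := by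
    intro a₁ a₂
    refine Eq.trans ?_ (map_add f (a₁, 0) (0, a₂))
    rw [Prod.mk_add_mk, add_zero, zero_add]
  have hinj : ∀ a₁ a₂, f₁ a₁ = f₂ a₂ → a₁ = 0 ∧ a₂ = 0 := by
    intro a₁ a₂ h
    have h0 : ((a₁, 0) : A₁ × A₂) = (0, a₂) := hf h
    exact ⟨congrArg Prod.fst h0, (congrArg Prod.snd h0).symm⟩
  have hex : ∀ m, g m = 0 ↔ ∃ a₁ a₂, f₁ a₁ + f₂ a₂ = m := by
    intro m
    rw [hfg m]
    constructor
    · rintro ⟨⟨a₁, a₂⟩, rfl⟩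
      exact ⟨a₁, a₂, (hf₁₂ a₁ a₂).symm⟩
    · rintro ⟨a₁, a₂, rfl⟩
      exact ⟨(a₁, a₂), hf₁₂ a₁ a₂⟩
  have hgf₁ : ∀ a, g (f₁ a) = 0 := fun a => (hfg _).2 ⟨(a, 0), rfl⟩
  have hgf₂ : ∀ a, g (f₂ a) = 0 := fun a => (hfg _).2 ⟨(0, a), rfl⟩
  obtain ⟨v, hv⟩ := hg (permBase p)
  obtain ⟨a₁, a₂, ha⟩ := (hex (ρ (r 1) v - v)).1 (by
    rw [map_sub, g.isIntertwining, permLattice_r, sub_self])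
  -- `T = (σ - 1) M` contains `f₁ a₁ + f₂ a₂` and its image under `τ`, which is `f₁ a₁ - f₂ a₂`
  -- modulo `T`; it also contains `p • f₁ a₁`, and `p` is odd.
  have hadd : f₁ a₁ + f₂ a₂ ∈ sigmaRange ρ := ha ▸ sub_mem_sigmaRange v
  have hsub : f₁ a₁ - f₂ a₂ ∈ sigmaRange ρ := by
    have h := sub_mem (sub_mem (apply_sr_mem_sigmaRange hadd) (map_sigmaRange f₁ (h₁ a₁)))
      (map_sigmaRange f₂ (h₂ a₂))
    rw [map_add, map_sub, map_add, f₁.isIntertwining, f₂.isIntertwining] at h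
    convert h using 1
    abel
  have hpa : p • a₁ ∈ sigmaRange α₁ := by
    have h := sum_mem (t := Finset.univ) fun (i : ZMod p) _ =>
      neg_mem (apply_r_sub_mem_sigmaRange (ρ := α₁) i a₁)
    simpa [hN₁] using h
  have hm₁ : f₁ a₁ ∈ sigmaRange ρ := by
    have h := add_mem hadd hsub
    rw [add_add_sub_cancel, ← two_nsmul] at h
    exact mem_of_odd_nsmul_mem hp h (map_nsmul f₁ p a₁ ▸ map_sigmaRange f₁ hpa)
  have hm₂ : f₂ a₂ ∈ sigmaRange ρ := by
    have h := sub_mem hadd hm₁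
    rwa [add_sub_cancel_left] at h
  have hall₁ : ∀ x, f₁ x ∈ sigmaRange ρ := by
    have hle : sigmaRange α₁ ≤ (sigmaRange ρ).comap f₁.toLinearMap :=
      fun a ha => map_sigmaRange f₁ ha
    rcases hα₁.le_iff.1 hle with h | h
    · exact fun x => h.ge (Submodule.mem_top (x := x))
    · exfalso
      have hmem : a₁ ∈ (sigmaRange ρ).comap f₁.toLinearMap := hm₁
      rw [h] at hmem
      obtain ⟨y, rfl⟩ := mem_sigmaRange.1 hmem
      have := hα₁.nontrivial
      refine not_isIndecomposable_of_apply_sub_mem f₂ f₁ g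
        (fun b₂ b₁ hb => (hinj b₁ b₂ hb.symm).symm)
        (fun m => (hex m).trans ⟨fun ⟨b₁, b₂, hb⟩ => ⟨b₂, b₁, by rw [add_comm, hb]⟩,
          fun ⟨b₂, b₁, hb⟩ => ⟨b₁, b₂, by rw [add_comm, hb]⟩⟩) (v := v - f₁ y)
        (by rw [map_sub, hv, hgf₁, sub_zero]) ⟨a₂, ?_⟩ hρ
      rw [map_sub, f₁.isIntertwining] at ha
      rw [map_sub, sub_sub_sub_comm, ← ha]
      abel
  have hall₂ : ∀ x, f₂ x ∈ sigmaRange ρ := by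
    have hle : sigmaRange α₂ ≤ (sigmaRange ρ).comap f₂.toLinearMap :=
      fun a ha => map_sigmaRange f₂ ha
    rcases hα₂.le_iff.1 hle with h | h
    · exact fun x => h.ge (Submodule.mem_top (x := x))
    · exfalso
      have hmem : a₂ ∈ (sigmaRange ρ).comap f₂.toLinearMap := hm₂
      rw [h] at hmem
      obtain ⟨y, rfl⟩ := mem_sigmaRange.1 hmem
      have := hα₂.nontrivial
      refine not_isIndecomposable_of_apply_sub_mem f₁ f₂ g hinj hex (v := v - f₂ y)
        (by rw [map_sub, hv, hgf₂, sub_zero]) ⟨a₁, ?_⟩ hρ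
      rw [map_sub, f₂.isIntertwining] at ha
      rw [map_sub, sub_sub_sub_comm, ← ha]
      abel
  have := isAddTorsionFree_perm (p := p)
  refine isFlabby_of_extension hp (hτ₁.prod hτ₂) tauExact_permLattice permLattice_r f g hf hfg hg ?_
  rintro ⟨x₁, x₂⟩
  rw [hf₁₂]
  exact add_mem (hall₁ x₁) (hall₂ x₂)

end IndecomposableExtension

/-! ### Stable ideals as lattices -/

section IdealLattice

variable {p : ℕ} [Fact p.Prime] {ζ : ℂ} (hζ : IsPrimitiveRoot ζ p) {I : Ideal (R ζ)}
  (hI : I.map (conjR hζ) ≤ I)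

theorem coe_idealLattice_r (i : ZMod p) (x : (idealLattice hζ I hI).toSubmodule) :
    ((idealLattice hζ I hI).toRepresentation (r i) x : R ζ) = zetaPow ζ i * x := rfl

theorem coe_idealLattice_sr_zero (x : (idealLattice hζ I hI).toSubmodule) :
    ((idealLattice hζ I hI).toRepresentation (sr 0) x : R ζ) = conjR hζ x := by
  change conjR hζ (zetaPow ζ (0 : ZMod p) * x) = _
  rw [zetaPow_zero, one_mul]

theorem sum_idealLattice_r (x : (idealLattice hζ I hI).toSubmodule) :
    ∑ i : ZMod p, (idealLattice hζ I hI).toRepresentation (r i) x = 0 := by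
  refine Subtype.ext ?_
  rw [AddSubmonoidClass.coe_finsetSum]
  simp only [coe_idealLattice_r]
  rw [← Finset.sum_mul, sum_zetaPow hζ, zero_mul]
  rfl

/-- If `c` has trace one and `x + τ x = 0`, then `x = c x + τ(c) x = c x - τ(c x)`. -/
theorem tauExact_idealLattice (hp : Odd p) : TauExact (idealLattice hζ I hI).toRepresentation := by
  intro x hx
  obtain ⟨c, hc⟩ := exists_add_conjR_eq_one hp hζ
  refine ⟨⟨-(c * x), neg_mem (I.mul_mem_left _ x.2)⟩, Subtype.ext ?_⟩
  rw [AddSubgroupClass.coe_sub, coe_idealLattice_sr_zero]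
  have hx' := congrArg Subtype.val hx
  rw [Submodule.coe_add, coe_idealLattice_sr_zero] at hx'
  simp only [map_neg, map_mul]
  rw [Submodule.coe_zero] at hx'
  linear_combination (x : R ζ) * hc - conjR hζ c * hx'

/-- If `c` has trace one and `τ x = x`, then `x = c x + τ(c x)`: the Tate group `H⁰(⟨τ⟩, I)`
vanishes. -/
theorem exists_add_idealLattice_sr (hp : Odd p) (x : (idealLattice hζ I hI).toSubmodule)
    (hx : (idealLattice hζ I hI).toRepresentation (sr 0) x = x) :
    ∃ y, y + (idealLattice hζ I hI).toRepresentation (sr 0) y = x := by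
  obtain ⟨c, hc⟩ := exists_add_conjR_eq_one hp hζ
  refine ⟨⟨c * x, I.mul_mem_left _ x.2⟩, Subtype.ext ?_⟩
  have hx' := congrArg Subtype.val hx
  rw [coe_idealLattice_sr_zero] at hx'
  rw [Submodule.coe_add, coe_idealLattice_sr_zero]
  simp only [map_mul]
  linear_combination (x : R ζ) * hc + conjR hζ c * hx'

theorem eq_zero_of_idealLattice_r_one (x : (idealLattice hζ I hI).toSubmodule)
    (hx : (idealLattice hζ I hI).toRepresentation (r 1) x = x) : x = 0 := by
  have hx' := congrArg Subtype.val hx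
  rw [coe_idealLattice_r, zetaPow_one] at hx'
  refine Subtype.ext ((mul_eq_zero (a := 1 - zeta ζ).1 ?_).resolve_left (one_sub_zeta_ne_zero hζ))
  linear_combination -hx'

theorem mem_sigmaRange_idealLattice_iff (x : (idealLattice hζ I hI).toSubmodule) :
    x ∈ sigmaRange (idealLattice hζ I hI).toRepresentation ↔ (x : R ζ) ∈ idealP ζ * I := by
  rw [mem_sigmaRange, mem_idealP_mul_iff]
  constructor
  · rintro ⟨y, rfl⟩
    refine ⟨-y, neg_mem y.2, ?_⟩
    rw [AddSubgroupClass.coe_sub, coe_idealLattice_r, zetaPow_one]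
    ring
  · rintro ⟨y, hy, hyx⟩
    refine ⟨⟨-y, neg_mem hy⟩, Subtype.ext ?_⟩
    rw [AddSubgroupClass.coe_sub, coe_idealLattice_r, zetaPow_one, ← hyx]
    ring

theorem sigmaMaximal_idealLattice (hI0 : I ≠ ⊥) :
    SigmaMaximal (idealLattice hζ I hI).toRepresentation := by
  constructor
  · obtain ⟨x, hx, hx'⟩ := exists_not_mem_idealP_mul hζ hI0
    intro h
    exact hx' ((mem_sigmaRange_idealLattice_iff hζ hI ⟨x, hx⟩).1 (h ▸ Submodule.mem_top))
  · intro T hT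
    obtain ⟨hle, a, haT, ha⟩ := SetLike.lt_iff_le_and_exists.1 hT
    rw [mem_sigmaRange_idealLattice_iff] at ha
    refine Submodule.eq_top_iff'.2 fun x => ?_
    obtain ⟨n, hn⟩ := exists_sub_mem_idealP_mul hζ a.2 ha x.2
    have h : x - n • a ∈ T := hle ((mem_sigmaRange_idealLattice_iff hζ hI _).2 (by
      rwa [AddSubgroupClass.coe_sub, AddSubgroupClass.coe_zsmul, zsmul_eq_mul]))
    have := add_mem h (zsmul_mem haT n)
    rwa [sub_add_cancel] at this

/-- The norm of `⟨σ⟩` vanishes on `I`, but `(σ - 1) I = P I` is smaller than `I`. -/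
theorem not_isFlabby_idealLattice (hI0 : I ≠ ⊥) :
    ¬ IsFlabby (idealLattice hζ I hI).toRepresentation := by
  intro h
  refine (sigmaMaximal_idealLattice hζ hI hI0).1 (Submodule.eq_top_iff'.2 fun x => ?_)
  exact h.mem_of_sum_r_eq_zero _ (fun i x => apply_r_sub_mem_sigmaRange i x) x
    (sum_idealLattice_r hζ hI x)

end IdealLattice

/-! ### Lattices with trivial action of `σ`, and quotients `ℤ₋` -/

section RankOne

variable {p : ℕ}

theorem tauExact_trivLattice : TauExact (trivLattice p) := by
  intro m hm
  rw [Representation.trivial_apply] at hm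
  exact ⟨0, by rw [map_zero]; lia⟩

variable [Fact p.Prime]

theorem isFlabby_of_sigma_trivial (hp : Odd p) {B : Type} [AddCommGroup B] [Module ℤ B]
    [IsAddTorsionFree B] {β : Representation ℤ (DihedralGroup p) B} (hβ : TauExact β)
    (hβr : ∀ i b, β (r i) b = b) : IsFlabby β := by
  refine isFlabby_of_sylow hp (fun m hm => ⟨0, ?_⟩) hβ
  simp only [hβr, Finset.sum_const, Finset.card_univ, ZMod.card] at hm
  rw [(nsmul_eq_zero_iff_right (Fact.out : p.Prime).ne_zero).1 hm, map_zero, sub_zero]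

/-- An element `m` with `m + τ m = 0` that maps to `1 ∈ ℤ₋` is not in `(τ - 1) M`, whose image in
`ℤ₋` is `2ℤ`. -/
theorem not_isFlabby_of_map_signLattice {M : Type} [AddCommGroup M] [Module ℤ M]
    {ρ : Representation ℤ (DihedralGroup p) M}
    (g : Representation.IntertwiningMap ρ (signLattice p)) {m : M} (hgm : g m = 1)
    (hm : m + ρ (sr 0) m = 0) : ¬ IsFlabby ρ := by
  intro h
  have h1 : m ∈ (Submodule.span ℤ {(2 : ℤ)}).comap g.toLinearMap := by
    refine h.mem_of_add_sr_eq_zero _ (fun x => ?_) m hm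
    change g (ρ (sr 0) x - x) ∈ Submodule.span ℤ {(2 : ℤ)}
    rw [map_sub, g.isIntertwining]
    change -g x - g x ∈ Submodule.span ℤ {(2 : ℤ)}
    exact Ideal.mem_span_singleton.2 ⟨-g x, by ring⟩
  have h2 : (2 : ℤ) ∣ g m := Ideal.mem_span_singleton.1 h1
  rw [hgm] at h2
  lia

end RankOne

/-! ### The extensions in the list -/

section Extensions

variable {p : ℕ} [Fact p.Prime] {ζ : ℂ} {hζ : IsPrimitiveRoot ζ p}
  {A : Ideal (R₀ ζ)} {M : Type} [AddCommGroup M] [Module ℤ M]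
  {ρ : Representation ℤ (DihedralGroup p) M}

theorem idealP_mul_ne_bot (hζ : IsPrimitiveRoot ζ p) (hA : A ≠ ⊥) :
    idealP ζ * extendIdeal hζ A ≠ ⊥ :=
  mul_ne_zero (idealP_ne_bot hζ) (extendIdeal_ne_bot hζ hA)

theorem isFlabby_of_isNonsplitExtension_permLattice (hp : Odd p) {I : Ideal (R ζ)}
    (hI : I.map (conjR hζ) ≤ I) (hI0 : I ≠ ⊥)
    (h : IsNonsplitExtension (idealLattice hζ I hI).toRepresentation (permLattice p) ρ) :
    IsFlabby ρ := by
  obtain ⟨f, g, hf, hfg, hg, hns⟩ := h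
  obtain ⟨v, hv⟩ := hg (permBase p)
  have := isAddTorsionFree_perm (p := p)
  refine isFlabby_of_extension hp (tauExact_idealLattice hζ hI hp) tauExact_permLattice
    permLattice_r f g hf hfg hg
    (mem_sigmaRange_of_forall_ne (v := v) (sigmaMaximal_idealLattice hζ hI hI0) permLattice_r f g
      hfg fun v' hv' hfix => hns ?_)
  exact exists_section_permLattice g (hv'.trans hv) hfix

theorem IsV.isFlabby (hp : Odd p) (hA : A ≠ ⊥) (h : IsV hζ A ρ) : IsFlabby ρ := by
  obtain ⟨f, g, hf, hfg, hg, hns⟩ := h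
  obtain ⟨v, hv⟩ := hg 1
  have htriv : ∀ (i : ZMod p) (b : ℤ), trivLattice p (r i) b = b := fun i b => rfl
  refine isFlabby_of_extension hp (tauExact_idealLattice hζ _ hp) tauExact_trivLattice
    htriv f g hf hfg hg
    (mem_sigmaRange_of_forall_ne (v := v)
      (sigmaMaximal_idealLattice hζ _ (idealP_mul_ne_bot hζ hA)) htriv f g
      hfg fun v' hv' hfix => hns ?_)
  exact exists_section_trivLattice (eq_zero_of_idealLattice_r_one hζ _) f g hf hfg
    (hv'.trans hv) hfix

theorem IsX.not_isFlabby (hp : Odd p) (h : IsX hζ A ρ) : ¬ IsFlabby ρ := by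
  obtain ⟨f, g, hf, hfg, hg, -⟩ := h
  obtain ⟨m, hm⟩ := hg 1
  obtain ⟨x, hx⟩ := (hfg (m + ρ (sr 0) m)).1 (by
    rw [map_add, g.isIntertwining, hm]
    exact add_neg_cancel (1 : ℤ))
  obtain ⟨y, rfl⟩ := exists_add_idealLattice_sr hζ _ hp x (hf (by
    rw [f.isIntertwining, hx, map_add, apply_sr_sr, add_comm]))
  -- `m + τ m` is a `τ`-invariant element of `RA`, hence a trace `y + τ y`
  refine not_isFlabby_of_map_signLattice g (m := m - f y) ?_ ?_
  · rw [map_sub, (hfg (f y)).2 ⟨y, rfl⟩, hm, sub_zero]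
  · rw [map_add, f.isIntertwining] at hx
    rw [map_sub, sub_add_sub_comm, hx, sub_self]

theorem IsY₂.isFlabby (hp : Odd p) (hA : A ≠ ⊥) (h : IsY₂ hζ A ρ) : IsFlabby ρ := by
  obtain ⟨⟨f, g, hf, hfg, hg, -⟩, hρ⟩ := h
  refine isFlabby_of_isIndecomposable hp
    (sigmaMaximal_idealLattice hζ _ (extendIdeal_ne_bot hζ hA))
    (sigmaMaximal_idealLattice hζ _ (idealP_ne_bot hζ)) (tauExact_idealLattice hζ _ hp)
    (tauExact_idealLattice hζ _ hp) (sum_idealLattice_r hζ _) ?_ ?_ f g hf hfg hg hρ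
  · intro a
    rw [mem_sigmaRange_idealLattice_iff, AddSubgroupClass.coe_sub, coe_idealLattice_sr_zero]
    exact conjR_sub_self_mem hζ A a.2
  · intro a
    rw [mem_sigmaRange_idealLattice_iff, Submodule.coe_add, coe_idealLattice_sr_zero]
    exact conjR_add_self_mem hζ a.2

end Extensions

end DpLattice

end

open DpLattice in
theorem proposition4p8 (p : ℕ) [Fact p.Prime] (hp : Odd p) (ζ : ℂ) (hζ : IsPrimitiveRoot ζ p) :
    (IsFlabby (trivLattice p) ∧ IsFlabby (permLattice p) ∧ ¬ IsFlabby (signLattice p)) ∧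
    ∀ A : Ideal (R₀ ζ), A ≠ ⊥ →
      (¬ IsFlabby (latticeRA hζ A) ∧ ¬ IsFlabby (latticePA hζ A)) ∧
      ∀ (M : Type) [AddCommGroup M] [Module.Free ℤ M] [Module.Finite ℤ M]
        (ρ : Representation ℤ (DihedralGroup p) M),
        (IsV hζ A ρ → IsFlabby ρ) ∧
        (IsX hζ A ρ → ¬ IsFlabby ρ) ∧
        (IsY₀ hζ A ρ → IsFlabby ρ) ∧
        (IsY₁ hζ A ρ → IsFlabby ρ) ∧
        (IsY₂ hζ A ρ → IsFlabby ρ) := by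
  have := isAddTorsionFree_perm (p := p)
  refine ⟨⟨isFlabby_of_sigma_trivial hp tauExact_trivLattice fun _ _ => rfl,
    isFlabby_of_sigma_trivial hp tauExact_permLattice permLattice_r,
    not_isFlabby_of_map_signLattice ⟨LinearMap.id, fun _ => rfl⟩ (m := (1 : ℤ)) rfl
      (add_neg_cancel (1 : ℤ))⟩, fun A hA => ⟨⟨?_, ?_⟩, fun M _ _ _ ρ => ⟨?_, ?_, ?_, ?_, ?_⟩⟩⟩
  · exact not_isFlabby_idealLattice hζ _ (extendIdeal_ne_bot hζ hA)
  · exact not_isFlabby_idealLattice hζ _ (idealP_mul_ne_bot hζ hA)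
  · exact fun h => h.isFlabby hp hA
  · exact fun h => h.not_isFlabby hp
  · exact fun h => isFlabby_of_isNonsplitExtension_permLattice hp _ (extendIdeal_ne_bot hζ hA) h
  · exact fun h => isFlabby_of_isNonsplitExtension_permLattice hp _ (idealP_mul_ne_bot hζ hA) h
  · exact fun h => h.isFlabby hp hA
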